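/- Let $n\ge 1$, $\delta>0$ and $\alpha\in\mathbb R$. Let $\{\Omega_t\}_{t\in[0,\delta]}$ be closed convex (possibly unbounded) subsets of $\mathbb R^{n+1}$ with nonempty interior, whose boundaries $M_t=\partial\Omega_t$ are smooth hypersurfaces evolving by mean curvature flow. That is, there are a smooth $n$-manifold $M$ and a map $X:M\times[0,\delta]\to\mathbb R^{n+1}$, smooth up to $t=0$ and $t=\delta$, such that each $X(\cdot,t)$ is a smooth embedding with image $M_t$ and $\partial_tX=-H\nu$, where $\nu(\cdot,t)$ is the outward unit normal to $M_t$ (a smooth field on $M\times[0,\delta]$). Let $g$ be the induced metric and $A(u,v)=\langle D_u\nu,D_vX\rangle$ the second fundamental form. Let $\kappa_1\le\dots\le\kappa_n$ be the principal curvatures (the eigenvalues of $A$ with respect to $g$), $H=\kappa_1+\dots+\kappa_n$ and $|A|^2=\kappa_1^2+\dots+\kappa_n^2$. Suppose that every $M_t$ is locally uniformly convex (each point of $M_t$ has a neighbourhood in $M_t$ on which $\kappa_1\ge c$ for some constant $c>0$) and that $$\sup_{t\in[0,\delta]}\sup_{M_t}|A|<\infty.$$ If $\kappa_1\ge\alpha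 H$ on $M_0$, then $$\kappa_1\ge\alpha H\quad\text{on } M_t\quad\text{for all } t\in[0,\delta].$$ -/

import Mathlib

open scoped Manifold ContDiff

namespace PinchedMCF

noncomputable section

/-- Euclidean space of dimension `k`. -/
abbrev Eucl (k : ℕ) : Type := EuclideanSpace ℝ (Fin k)

section Geometry

variable {n : ℕ} {M : Type*} [TopologicalSpace M] [ChartedSpace (Eucl n) M]

/-- The differential at `x` of a map `f` from an `n`-manifold into `ℝⁿ⁺¹`. The tangent space at `x`
is identified with `ℝⁿ` by the coordinate frame of the preferred chart at `x`. -/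
def differential (f : M → Eucl (n + 1)) (x : M) : Eucl n →L[ℝ] Eucl (n + 1) :=
  mfderiv (𝓡 n) 𝓘(ℝ, Eucl (n + 1)) f x

/-- The coordinate tangent vector `∂_i f` of a parametrised hypersurface `f`. -/
def coordVector (f : M → Eucl (n + 1)) (x : M) (i : Fin n) : Eucl (n + 1) :=
  differential f x (EuclideanSpace.single i (1 : ℝ))

/-- The induced metric (first fundamental form) in coordinates, `g_ij = ⟨∂_i f, ∂_j f⟩`. -/
def metricMatrix (f : M → Eucl (n + 1)) (x : M) : Matrix (Fin n) (Fin n) ℝ :=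
  Matrix.of fun i j => inner ℝ (coordVector f x i) (coordVector f x j)

/-- The second fundamental form `A` with respect to the unit normal field `ν`, in coordinates,
`A_ij = ⟨∂_i ν, ∂_j f⟩`. With `ν` pointing outwards it is positive on round spheres. -/
def secondFundamentalMatrix (f ν : M → Eucl (n + 1)) (x : M) : Matrix (Fin n) (Fin n) ℝ :=
  Matrix.of fun i j => inner ℝ (coordVector ν x i) (coordVector f x j)

/-- The Weingarten map `g⁻¹ A` in coordinates. -/
def weingartenMatrix (f ν : M → Eucl (n + 1)) (x : M) : Matrix (Fin n) (Fin n) ℝ :=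
  (metricMatrix f x)⁻¹ * secondFundamentalMatrix f ν x

/-- The principal curvatures at `x`: the eigenvalues of `A` with respect to `g`. -/
def principalCurvatures (f ν : M → Eucl (n + 1)) (x : M) : Set ℝ :=
  spectrum ℝ (weingartenMatrix f ν x)

/-- The smallest principal curvature `κ₁` at `x` (the principal curvatures form a finite set, which
is nonempty when `n ≥ 1`). -/
def kappaOne (f ν : M → Eucl (n + 1)) (x : M) : ℝ :=
  sInf (principalCurvatures f ν x)

/-- The mean curvature `H = g^{ij} A_ij`, the sum of the principal curvatures with multiplicity. -/
def meanCurvature (f ν : M → Eucl (n + 1)) (x : M) : ℝ :=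
  (weingartenMatrix f ν x).trace

/-- The norm `|A|`, where `|A|² = g^{ij} g^{kl} A_ik A_jl`. -/
def normA (f ν : M → Eucl (n + 1)) (x : M) : ℝ :=
  Real.sqrt (weingartenMatrix f ν x * weingartenMatrix f ν x).trace

/-- `f` is a smooth embedding whose image is the whole boundary of the convex body `Ω` (a closed
convex set with nonempty interior, not necessarily bounded), and `ν` is its smooth outward unit
normal field. -/
structure IsConvexHypersurface (Ω : Set (Eucl (n + 1))) (f ν : M → Eucl (n + 1)) : Prop where
  isClosed : IsClosed Ω
  convex : Convex ℝ Ω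
  interior_nonempty : (interior Ω).Nonempty
  contMDiff : ContMDiff (𝓡 n) 𝓘(ℝ, Eucl (n + 1)) ∞ f
  immersion : ∀ x, Function.Injective (differential f x)
  isEmbedding : Topology.IsEmbedding f
  range_eq : Set.range f = frontier Ω
  normal_contMDiff : ContMDiff (𝓡 n) 𝓘(ℝ, Eucl (n + 1)) ∞ ν
  norm_normal : ∀ x, ‖ν x‖ = 1
  normal_orthogonal : ∀ x v, inner ℝ (differential f x v) (ν x) = 0
  normal_outward : ∀ x, ∀ y ∈ Ω, inner ℝ (y - f x) (ν x) ≤ 0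

/-- Local uniform convexity: near each point the principal curvatures are bounded below by a
positive constant. -/
def IsLocallyUniformlyConvex (f ν : M → Eucl (n + 1)) : Prop :=
  ∀ x, ∃ c : ℝ, 0 < c ∧ ∀ᶠ y in nhds x, c ≤ kappaOne f ν y

/-- The convex hypersurfaces `M_t = ∂Ω_t = X_t(M)`, `t ∈ [0, δ]`, evolve by mean curvature flow:
`X` is smooth on `M × [0, δ]` and `∂_t X = -H ν` with `ν` the outward unit normal. -/
structure IsConvexMeanCurvatureFlow (δ : ℝ) (Ω : ℝ → Set (Eucl (n + 1)))
    (X ν : ℝ → M → Eucl (n + 1)) : Prop where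
  smooth : ContMDiffOn ((𝓡 n).prod 𝓘(ℝ, ℝ)) 𝓘(ℝ, Eucl (n + 1)) ∞
    (fun p : M × ℝ => X p.2 p.1) (Set.univ ×ˢ Set.Icc 0 δ)
  normal_smooth : ContMDiffOn ((𝓡 n).prod 𝓘(ℝ, ℝ)) 𝓘(ℝ, Eucl (n + 1)) ∞
    (fun p : M × ℝ => ν p.2 p.1) (Set.univ ×ˢ Set.Icc 0 δ)
  hypersurface : ∀ t ∈ Set.Icc 0 δ, IsConvexHypersurface (Ω t) (X t) (ν t)
  evolves : ∀ t ∈ Set.Icc 0 δ, ∀ x,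
    HasDerivWithinAt (fun s => X s x) (-(meanCurvature (X t) (ν t) x) • ν t x) (Set.Icc 0 δ) t

end Geometry

end

end PinchedMCF

/-! This is Hamilton's tensor maximum principle for `A - αHg`, with a barrier that replaces
compactness. Let `K` exceed the supremum of `|A|²` and put `Q = e^{-Kt}(κ₁ - αH) + ε(|X|² + 2nt)`.
If pinching fails at some point, then `Q < 0` there for small `ε`. Since `H` is bounded and `κ₁ >
0`, `Q` is positive where `|X|` is large. Points move at bounded speed and `X(·, 0)` is a closed
embedding, so the remaining region is compact in space-time. `Q` is lower semicontinuous and attains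
a negative minimum `-m`, at a positive time because of the initial pinching. Up to that time `κ₁ ≥
αH - η` with `η = e^{Kt}(ε(|X|² + 2nt) + m)`, and equality holds at the minimum.

Such a touching is impossible (`IsGraphFlow.not_touching`). Choose coordinates, fixed in time, in
which the hypersurface at the touching time `t₀` is the graph of a function `u` over its tangent
plane. Let `v` be a unit eigenvector for `κ₁` at the centre, extended with constant coefficients.
Then `A(v,v) - (αH - η)g(v,v)` is nonnegative for `t ≤ t₀` and vanishes at the centre. Its time
derivative there is at most zero and its second space derivatives are at least zero. All of these
are explicit in the derivatives of `u`; commuting fourth partial derivatives of `u` plays the role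
of Simons' identity. Because `|X|² + 2nt` solves the heat equation along the flow, the `ε` terms
cancel, as do the second derivatives of `H`. What is left is `(K - |A|²)η ≤ 0`, a contradiction. The
dependence on `H` is linear, so the sign of `α` plays no role.

The smallest eigenvalue need not be differentiable. It enters only as the minimum of a Rayleigh
quotient (`exists_rayleigh_min`), which gives both its semicontinuity and the test direction `v`. -/

open Filter Topology

namespace PinchedMCF

/-! ### Linear algebra of the Weingarten map in an arbitrary frame -/

section LinearAlgebra

variable {n : ℕ} {V : Type*} [NormedAddCommGroup V] [InnerProductSpace ℝ V]

/-- The matrix of inner products `⟨K e_i, L e_j⟩` of two linear maps on `ℝⁿ`. -/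
noncomputable def pairing (K L : Eucl n →L[ℝ] V) : Matrix (Fin n) (Fin n) ℝ :=
  Matrix.of fun i j =>
    inner ℝ (K (EuclideanSpace.single i (1 : ℝ))) (L (EuclideanSpace.single j (1 : ℝ)))

/-- The Weingarten matrix of a frame `L` and the differential `N` of a normal field. -/
noncomputable def shapeMatrix (L N : Eucl n →L[ℝ] V) : Matrix (Fin n) (Fin n) ℝ :=
  (pairing L L)⁻¹ * pairing N L

theorem eucl_eq_sum (x : Eucl n) : x = ∑ i, x i • EuclideanSpace.single i (1 : ℝ) := by
  ext j
  simp [Pi.single_apply]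

theorem map_eq_sum (K : Eucl n →L[ℝ] V) (x : Eucl n) :
    K x = ∑ i, x i • K (EuclideanSpace.single i (1 : ℝ)) := by
  conv_lhs => rw [eucl_eq_sum x]
  simp

theorem inner_eq_pairing (K L : Eucl n →L[ℝ] V) (x y : Eucl n) :
    inner ℝ (K x) (L y) = x.ofLp ⬝ᵥ (pairing K L).mulVec y.ofLp := by
  rw [map_eq_sum K x, map_eq_sum L y]
  simp only [dotProduct, Matrix.mulVec, pairing, Matrix.of_apply, sum_inner, inner_sum,
    real_inner_smul_left, real_inner_smul_right, Finset.mul_sum]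
  rw [Finset.sum_comm]
  refine Finset.sum_congr rfl fun i _ => Finset.sum_congr rfl fun j _ => by ring

/-- The matrix of an endomorphism of `ℝⁿ`. -/
noncomputable def endMatrix (B : Eucl n →L[ℝ] Eucl n) : Matrix (Fin n) (Fin n) ℝ :=
  Matrix.of fun i j => B (EuclideanSpace.single j (1 : ℝ)) i

theorem endMatrix_mulVec (B : Eucl n →L[ℝ] Eucl n) (x : Eucl n) :
    (endMatrix B).mulVec x.ofLp = (B x).ofLp := by
  ext i
  rw [map_eq_sum B x]
  simp [Matrix.mulVec, dotProduct, endMatrix, mul_comm]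

theorem isUnit_det_endMatrix {B : Eucl n →L[ℝ] Eucl n} (hB : Function.Injective B) :
    IsUnit (endMatrix B).det := by
  rw [← Matrix.isUnit_iff_isUnit_det, ← Matrix.mulVec_injective_iff_isUnit]
  intro x y hxy
  have h := endMatrix_mulVec B (WithLp.toLp 2 x)
  have h' := endMatrix_mulVec B (WithLp.toLp 2 y)
  have hxy' : (B (WithLp.toLp 2 x)).ofLp = (B (WithLp.toLp 2 y)).ofLp := by
    rw [← h, ← h']; exact hxy
  have := hB ((WithLp.ofLp_injective 2) hxy')
  exact (WithLp.toLp_injective 2) this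

theorem pairing_comp (K L : Eucl n →L[ℝ] V) (B : Eucl n →L[ℝ] Eucl n) :
    pairing (K.comp B) (L.comp B) = (endMatrix B).transpose * pairing K L * endMatrix B := by
  ext i j
  have h := inner_eq_pairing K L (B (EuclideanSpace.single i (1 : ℝ)))
    (B (EuclideanSpace.single j (1 : ℝ)))
  simp only [pairing, Matrix.of_apply, ContinuousLinearMap.comp_apply] at h ⊢
  rw [h, Matrix.mul_assoc, Matrix.mul_apply]
  simp only [dotProduct, Matrix.transpose_apply, endMatrix, Matrix.of_apply, Matrix.mul_apply,
    Matrix.mulVec]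

theorem isUnit_det_pairing_self {L : Eucl n →L[ℝ] V} (hL : Function.Injective L) :
    IsUnit (pairing L L).det := by
  rw [← Matrix.isUnit_iff_isUnit_det, ← Matrix.mulVec_injective_iff_isUnit]
  intro x y hxy
  have h := inner_eq_pairing L L (WithLp.toLp 2 (x - y)) (WithLp.toLp 2 (x - y))
  have hxy' : (pairing L L).mulVec (x - y) = 0 := by
    rw [Matrix.mulVec_sub]; exact sub_eq_zero.2 hxy
  simp only [hxy', dotProduct_zero, inner_self_eq_zero] at h
  have h0 : WithLp.toLp 2 (x - y) = (0 : Eucl n) := hL (by rw [h, map_zero])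
  exact sub_eq_zero.1 ((WithLp.toLp_injective 2) h0)

/-- A change of frame conjugates the Weingarten matrix, so its trace, the trace of its square and
its spectrum do not depend on the coordinates. -/
theorem shapeMatrix_comp {L N : Eucl n →L[ℝ] V} {B : Eucl n →L[ℝ] Eucl n}
    (hB : Function.Injective B) :
    shapeMatrix (L.comp B) (N.comp B) =
      (endMatrix B)⁻¹ * shapeMatrix L N * endMatrix B := by
  have hb := isUnit_det_endMatrix hB
  have hbt : IsUnit (endMatrix B).transpose.det := by rwa [Matrix.det_transpose]
  rw [shapeMatrix, shapeMatrix, pairing_comp, pairing_comp, Matrix.mul_inv_rev,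
    Matrix.mul_inv_rev]
  simp only [Matrix.mul_assoc]
  rw [Matrix.nonsing_inv_mul_cancel_left _ _ hbt]

theorem trace_shapeMatrix_comp {L N : Eucl n →L[ℝ] V} {B : Eucl n →L[ℝ] Eucl n}
    (hB : Function.Injective B) :
    (shapeMatrix (L.comp B) (N.comp B)).trace = (shapeMatrix L N).trace := by
  rw [shapeMatrix_comp hB, Matrix.trace_mul_comm, ← Matrix.mul_assoc,
    Matrix.mul_nonsing_inv _ (isUnit_det_endMatrix hB), Matrix.one_mul]

theorem trace_sq_shapeMatrix_comp {L N : Eucl n →L[ℝ] V} {B : Eucl n →L[ℝ] Eucl n}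
    (hB : Function.Injective B) :
    (shapeMatrix (L.comp B) (N.comp B) * shapeMatrix (L.comp B) (N.comp B)).trace =
      (shapeMatrix L N * shapeMatrix L N).trace := by
  have hb := isUnit_det_endMatrix hB
  rw [shapeMatrix_comp hB, Matrix.trace_mul_comm]
  have h : ∀ W : Matrix (Fin n) (Fin n) ℝ,
      (endMatrix B)⁻¹ * W * endMatrix B * ((endMatrix B)⁻¹ * W * endMatrix B) =
        (endMatrix B)⁻¹ * (W * W * endMatrix B) := by
    intro W
    simp only [Matrix.mul_assoc]
    rw [Matrix.mul_nonsing_inv_cancel_left _ _ hb]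
  rw [h, Matrix.trace_mul_comm, Matrix.mul_assoc, Matrix.mul_nonsing_inv _ hb, Matrix.mul_one]

/-- A minimiser of the Rayleigh quotient is an eigenvector. -/
theorem inner_eq_of_rayleigh_le {L N : Eucl n →L[ℝ] V} {μ : ℝ} {w : Eucl n}
    (hs : ∀ x y, inner ℝ (N x) (L y) = inner ℝ (N y) (L x))
    (hle : ∀ x, μ * ‖L x‖ ^ 2 ≤ inner ℝ (N x) (L x))
    (hweq : inner ℝ (N w) (L w) = μ * ‖L w‖ ^ 2) (y : Eucl n) :
    inner ℝ (N y) (L w) = μ * inner ℝ (L y) (L w) := by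
  have hq : ∀ s : ℝ, 0 ≤ s * (2 * (inner ℝ (N y) (L w) - μ * inner ℝ (L y) (L w))) +
      s ^ 2 * (inner ℝ (N y) (L y) - μ * ‖L y‖ ^ 2) := by
    intro s
    have h := hle (w + s • y)
    rw [← real_inner_self_eq_norm_sq] at h hweq ⊢
    simp only [map_add, map_smul, inner_add_left, inner_add_right, real_inner_smul_left,
      real_inner_smul_right, hs w y, real_inner_comm (L y) (L w)] at h
    rw [real_inner_comm (L w) (L y)] at h ⊢
    nlinarith
  set b := inner ℝ (N y) (L w) - μ * inner ℝ (L y) (L w)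
  set c := inner ℝ (N y) (L y) - μ * ‖L y‖ ^ 2
  have hc : 0 ≤ c := sub_nonneg.2 (hle y)
  have hb : b = 0 := by
    by_contra hb
    -- At this `s` the quadratic is negative unless `b = 0`. Dividing by `c + 1` rather than `c`
    -- covers the case `c = 0`.
    have h := hq (-b / (c + 1))
    have hc1 : 0 < c + 1 := by linarith
    have : -b / (c + 1) * (2 * b) + (-b / (c + 1)) ^ 2 * c
        = -(b ^ 2 * (c + 2)) / (c + 1) ^ 2 := by
      field_simp; ring
    rw [this] at h
    have h2 : 0 < b ^ 2 * (c + 2) / (c + 1) ^ 2 := by positivity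
    rw [neg_div] at h
    linarith
  exact sub_eq_zero.1 hb

/-- The smallest principal curvature is the minimum of the Rayleigh quotient. -/
theorem exists_rayleigh_min (hn : 1 ≤ n) {L N : Eucl n →L[ℝ] V} (hL : Function.Injective L)
    (hs : ∀ x y, inner ℝ (N x) (L y) = inner ℝ (N y) (L x)) :
    ∃ w : Eucl n, ‖w‖ = 1 ∧
      inner ℝ (N w) (L w) = sInf (spectrum ℝ (shapeMatrix L N)) * ‖L w‖ ^ 2 ∧
      ∀ x, sInf (spectrum ℝ (shapeMatrix L N)) * ‖L x‖ ^ 2 ≤ inner ℝ (N x) (L x) := by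
  have hpos : ∀ x : Eucl n, x ≠ 0 → 0 < ‖L x‖ ^ 2 := fun x hx => by
    have : L x ≠ 0 := fun h => hx (hL (by rw [h, map_zero]))
    positivity
  -- eigenvalues in terms of vectors
  have hspec : ∀ μ : ℝ, μ ∈ spectrum ℝ (shapeMatrix L N) ↔
      ∃ x : Eucl n, x ≠ 0 ∧ ∀ y, inner ℝ (N y) (L x) = μ * inner ℝ (L y) (L x) := by
    intro μ
    have hu := isUnit_det_pairing_self hL
    have key : ∀ x : Eucl n, (shapeMatrix L N).mulVec x.ofLp = μ • x.ofLp ↔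
        ∀ y, inner ℝ (N y) (L x) = μ * inner ℝ (L y) (L x) := by
      intro x
      have h1 : (shapeMatrix L N).mulVec x.ofLp = μ • x.ofLp ↔
          (pairing N L).mulVec x.ofLp = μ • (pairing L L).mulVec x.ofLp := by
        constructor
        · intro h
          have := congrArg (pairing L L).mulVec h
          rwa [shapeMatrix, Matrix.mulVec_mulVec, Matrix.mul_nonsing_inv_cancel_left _ _ hu,
            Matrix.mulVec_smul] at this
        · intro h
          rw [shapeMatrix, ← Matrix.mulVec_mulVec, h, Matrix.mulVec_smul, Matrix.mulVec_mulVec,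
            Matrix.nonsing_inv_mul _ hu, Matrix.one_mulVec]
      rw [h1]
      constructor
      · intro h y
        rw [inner_eq_pairing, inner_eq_pairing, h, dotProduct_smul, smul_eq_mul]
      · intro h
        ext i
        have := h (EuclideanSpace.single i 1)
        rw [inner_eq_pairing, inner_eq_pairing] at this
        simpa using this
    rw [spectrum.mem_iff, Matrix.isUnit_iff_isUnit_det, isUnit_iff_ne_zero, not_not,
      ← Matrix.exists_mulVec_eq_zero_iff]
    constructor
    · rintro ⟨v, hv, h⟩
      refine ⟨WithLp.toLp 2 v, fun h0 => hv ((WithLp.toLp_injective 2) h0), (key _).1 ?_⟩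
      rw [Matrix.sub_mulVec, sub_eq_zero, Algebra.algebraMap_eq_smul_one, Matrix.smul_mulVec,
        Matrix.one_mulVec] at h
      exact h.symm
    · rintro ⟨x, hx, h⟩
      refine ⟨x.ofLp, fun h0 => hx ((WithLp.ofLp_injective 2) h0), ?_⟩
      rw [Matrix.sub_mulVec, sub_eq_zero, Algebra.algebraMap_eq_smul_one, Matrix.smul_mulVec,
        Matrix.one_mulVec]
      exact ((key x).2 h).symm
  have : Nonempty (Fin n) := ⟨⟨0, hn⟩⟩
  have hne : (Metric.sphere (0 : Eucl n) 1).Nonempty :=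
    NormedSpace.sphere_nonempty.2 zero_le_one
  have hcont : ContinuousOn (fun x : Eucl n => inner ℝ (N x) (L x) / ‖L x‖ ^ 2)
      (Metric.sphere (0 : Eucl n) 1) := by
    refine ContinuousOn.div (by fun_prop) (by fun_prop) fun x hx => (hpos x ?_).ne'
    rintro rfl
    simp at hx
  -- The quotient is homogeneous of degree zero, so its minimum over the Euclidean unit sphere is
  -- its minimum over all nonzero vectors.
  obtain ⟨w, hw, hmin⟩ := (isCompact_sphere (0 : Eucl n) 1).exists_isMinOn hne hcont
  have hw1 : ‖w‖ = 1 := by simpa using hw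
  have hw0 : w ≠ 0 := by rintro rfl; simp at hw1
  set μ := inner ℝ (N w) (L w) / ‖L w‖ ^ 2 with hμ
  have hle : ∀ x, μ * ‖L x‖ ^ 2 ≤ inner ℝ (N x) (L x) := by
    intro x
    by_cases hx : x = 0
    · simp [hx]
    have hx' : (‖x‖⁻¹ • x) ∈ Metric.sphere (0 : Eucl n) 1 := by
      simp [norm_smul, inv_mul_cancel₀ (norm_ne_zero_iff.2 hx)]
    have := hmin hx'
    have hnx : ‖x‖⁻¹ ≠ 0 := inv_ne_zero (norm_ne_zero_iff.2 hx)
    simp only [Set.mem_ofPred_eq, map_smul, real_inner_smul_left, real_inner_smul_right,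
      norm_smul, norm_inv, norm_norm, mul_pow] at this
    rw [← mul_assoc, ← sq, mul_div_mul_left _ _ (pow_ne_zero 2 hnx), le_div_iff₀ (hpos x hx)]
      at this
    exact this
  have hweq : inner ℝ (N w) (L w) = μ * ‖L w‖ ^ 2 := by
    rw [hμ, div_mul_cancel₀ _ (hpos w hw0).ne']
  have hmem : μ ∈ spectrum ℝ (shapeMatrix L N) := by
    refine (hspec μ).2 ⟨w, hw0, fun y => ?_⟩
    exact inner_eq_of_rayleigh_le hs hle hweq y
  -- An eigenvalue is the value of the Rayleigh quotient at its eigenvector, hence at least `μ`,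
  -- which is itself an eigenvalue.
  have hinf : sInf (spectrum ℝ (shapeMatrix L N)) = μ := by
    refine IsLeast.csInf_eq ⟨hmem, fun κ hκ => ?_⟩
    obtain ⟨x, hx, h⟩ := (hspec κ).1 hκ
    have h1 := h x
    have h2 := hle x
    rw [h1, real_inner_self_eq_norm_sq] at h2
    exact le_of_mul_le_mul_right h2 (hpos x hx)
  exact ⟨w, hw1, by rw [hinf, hweq], by rw [hinf]; exact hle⟩

/-- A linear isometry onto the range of an injective linear map. -/
theorem exists_isometry_range_eq {L : Eucl n →L[ℝ] V} (hL : Function.Injective L) :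
    ∃ (J : Eucl n →ₗᵢ[ℝ] V) (B : Eucl n →L[ℝ] Eucl n), Function.Injective B ∧
      L.comp B = J.toContinuousLinearMap := by
  let R := LinearMap.range (L : Eucl n →ₗ[ℝ] V)
  have hL' : Function.Injective (L : Eucl n →ₗ[ℝ] V) := hL
  have hfr : Module.finrank ℝ R = n := by
    rw [LinearMap.finrank_range_of_inj hL']; simp
  let b : OrthonormalBasis (Fin n) ℝ R := (stdOrthonormalBasis ℝ R).reindex (finCongr hfr)
  let J : Eucl n →ₗᵢ[ℝ] V := R.subtypeₗᵢ.comp b.repr.symm.toLinearIsometry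
  let e : Eucl n ≃ₗ[ℝ] R := LinearEquiv.ofInjective (L : Eucl n →ₗ[ℝ] V) hL'
  let B : Eucl n →ₗ[ℝ] Eucl n := e.symm.toLinearMap ∘ₗ b.repr.symm.toLinearEquiv.toLinearMap
  have hJ : ∀ x, L (B x) = J x := by
    intro x
    have : (e (e.symm (b.repr.symm x)) : V) = b.repr.symm x := by rw [LinearEquiv.apply_symm_apply]
    exact this
  refine ⟨J, LinearMap.toContinuousLinearMap B, ?_, ?_⟩
  · intro x y hxy
    apply J.injective
    rw [← hJ, ← hJ]
    exact congrArg L hxy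
  · ext x : 1
    exact hJ x

theorem pairing_isometry (J : Eucl n →ₗᵢ[ℝ] V) :
    pairing J.toContinuousLinearMap J.toContinuousLinearMap = 1 := by
  ext i j
  simp [pairing, Matrix.one_apply, EuclideanSpace.inner_single_left]

theorem trace_sq_shapeMatrix_isometry {J : Eucl n →ₗᵢ[ℝ] V} {N : Eucl n →L[ℝ] V}
    (hs : ∀ x y, inner ℝ (N x) (J y) = inner ℝ (N y) (J x)) :
    (shapeMatrix J.toContinuousLinearMap N * shapeMatrix J.toContinuousLinearMap N).trace =
      ∑ i, ∑ j, (inner ℝ (N (EuclideanSpace.single i (1 : ℝ)))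
        (J (EuclideanSpace.single j (1 : ℝ)))) ^ 2 := by
  rw [shapeMatrix, pairing_isometry, inv_one, Matrix.one_mul]
  simp only [Matrix.trace, Matrix.diag, Matrix.mul_apply, pairing, Matrix.of_apply, LinearIsometry.coe_toContinuousLinearMap]
  refine Finset.sum_congr rfl fun i _ => Finset.sum_congr rfl fun j _ => ?_
  rw [hs (EuclideanSpace.single j 1), sq]

/-- In an orthonormal frame the Weingarten matrix is symmetric, so the trace of its square is the
sum of the squares of its entries. Cauchy–Schwarz on the diagonal gives `H² ≤ n|A|²`. Nonnegativity
ensures that the square root defining `normA` loses nothing. -/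
theorem sq_trace_shapeMatrix_le {L N : Eucl n →L[ℝ] V} (hL : Function.Injective L)
    (hs : ∀ x y, inner ℝ (N x) (L y) = inner ℝ (N y) (L x)) :
    0 ≤ (shapeMatrix L N * shapeMatrix L N).trace ∧
    (shapeMatrix L N).trace ^ 2 ≤ n * (shapeMatrix L N * shapeMatrix L N).trace := by
  obtain ⟨J, B, hB, hJ⟩ := exists_isometry_range_eq hL
  have hLB : ∀ x, L (B x) = J x := fun x => by
    rw [← ContinuousLinearMap.comp_apply, hJ]; rfl
  rw [← trace_shapeMatrix_comp hB, ← trace_sq_shapeMatrix_comp hB, hJ,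
    trace_sq_shapeMatrix_isometry (fun x y => by
      simp only [ContinuousLinearMap.comp_apply, ← hLB]; exact hs _ _)]
  refine ⟨by positivity, ?_⟩
  rw [shapeMatrix, pairing_isometry, inv_one, Matrix.one_mul]
  simp only [Matrix.trace, Matrix.diag, pairing, Matrix.of_apply, LinearIsometry.coe_toContinuousLinearMap]
  refine (sq_sum_le_card_mul_sum_sq).trans ?_
  rw [Finset.card_univ, Fintype.card_fin]
  refine mul_le_mul_of_nonneg_left (Finset.sum_le_sum fun i _ => ?_) (Nat.cast_nonneg n)
  exact Finset.single_le_sum (f := fun j => (inner ℝ ((N.comp B) (EuclideanSpace.single i (1 : ℝ)))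
        (J (EuclideanSpace.single j (1 : ℝ)))) ^ 2) (fun j _ => sq_nonneg _) (Finset.mem_univ i)

end LinearAlgebra

/-! ### Semicontinuity of the smallest principal curvature -/

section Continuity

variable {n : ℕ} {V : Type*} [NormedAddCommGroup V] [InnerProductSpace ℝ V]
  {T : Type*} {l : Filter T} {L N : T → Eucl n →L[ℝ] V} {L₀ N₀ : Eucl n →L[ℝ] V}

theorem tendsto_pairing (hL : Tendsto L l (𝓝 L₀)) (hN : Tendsto N l (𝓝 N₀)) :
    Tendsto (fun q => pairing (L q) (N q)) l (𝓝 (pairing L₀ N₀)) := by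
  have : Continuous fun p : (Eucl n →L[ℝ] V) × (Eucl n →L[ℝ] V) => pairing p.1 p.2 := by
    refine continuous_matrix fun i j => ?_
    simp only [pairing, Matrix.of_apply]
    fun_prop
  exact (this.tendsto (L₀, N₀)).comp (hL.prodMk_nhds hN)

theorem tendsto_shapeMatrix (hL : Tendsto L l (𝓝 L₀)) (hN : Tendsto N l (𝓝 N₀))
    (hinj : Function.Injective L₀) :
    Tendsto (fun q => shapeMatrix (L q) (N q)) l (𝓝 (shapeMatrix L₀ N₀)) := by
  have hinv : ContinuousAt Inv.inv (pairing L₀ L₀) := by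
    refine continuousAt_matrix_inv _ ?_
    have hu := (isUnit_det_pairing_self hinj).ne_zero
    rw [Ring.inverse_eq_inv']
    exact continuousAt_inv₀ hu
  have h1 : Tendsto (fun q => (pairing (L q) (L q))⁻¹) l (𝓝 (pairing L₀ L₀)⁻¹) :=
    hinv.tendsto.comp (tendsto_pairing hL hL)
  have h2 := tendsto_pairing hN hL
  have h3 : Continuous fun p : Matrix (Fin n) (Fin n) ℝ × Matrix (Fin n) (Fin n) ℝ =>
      p.1 * p.2 := continuous_fst.matrix_mul continuous_snd
  exact (h3.tendsto _).comp (h1.prodMk_nhds h2)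

theorem tendsto_trace_shapeMatrix (hL : Tendsto L l (𝓝 L₀)) (hN : Tendsto N l (𝓝 N₀))
    (hinj : Function.Injective L₀) :
    Tendsto (fun q => (shapeMatrix (L q) (N q)).trace) l (𝓝 (shapeMatrix L₀ N₀).trace) :=
  ((continuous_id.matrix_trace).tendsto _).comp (tendsto_shapeMatrix hL hN hinj)

/-- Lower semicontinuity of the smallest principal curvature. -/
theorem eventually_lt_sInf_spectrum (hn : 1 ≤ n) {c : T → ℝ} {c₀ : ℝ}
    (hL : Tendsto L l (𝓝 L₀)) (hN : Tendsto N l (𝓝 N₀)) (hc : Tendsto c l (𝓝 c₀))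
    (hinj₀ : Function.Injective L₀)
    (hs₀ : ∀ x y, inner ℝ (N₀ x) (L₀ y) = inner ℝ (N₀ y) (L₀ x))
    (hinj : ∀ᶠ q in l, Function.Injective (L q))
    (hs : ∀ᶠ q in l, ∀ x y, inner ℝ (N q x) (L q y) = inner ℝ (N q y) (L q x))
    (h : c₀ < sInf (spectrum ℝ (shapeMatrix L₀ N₀))) :
    ∀ᶠ q in l, c q < sInf (spectrum ℝ (shapeMatrix (L q) (N q))) := by
  obtain ⟨-, -, -, hmin⟩ := exists_rayleigh_min hn hinj₀ hs₀
  -- Strict inequality at each unit vector is an open condition; compactness of the sphere makes it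
  -- uniform in `w`.
  have hopen : ∀ᶠ p in 𝓝 (L₀, N₀, c₀), ∀ w ∈ Metric.sphere (0 : Eucl n) 1,
      p.2.2 * ‖p.1 w‖ ^ 2 < inner ℝ (p.2.1 w) (p.1 w) := by
    refine (isCompact_sphere (0 : Eucl n) 1).eventually_forall_of_forall_eventually fun w hw => ?_
    have hw0 : L₀ w ≠ 0 := by
      intro h0
      have : w = 0 := hinj₀ (by rw [h0, map_zero])
      simp [this] at hw
    have hlt : c₀ * ‖L₀ w‖ ^ 2 < inner ℝ (N₀ w) (L₀ w) :=
      lt_of_lt_of_le (mul_lt_mul_of_pos_right h (by positivity)) (hmin w)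
    have hc1 : Continuous fun z : ((Eucl n →L[ℝ] V) × (Eucl n →L[ℝ] V) × ℝ) × Eucl n =>
        z.1.2.2 * ‖z.1.1 z.2‖ ^ 2 := by fun_prop
    have hc2 : Continuous fun z : ((Eucl n →L[ℝ] V) × (Eucl n →L[ℝ] V) × ℝ) × Eucl n =>
        (inner ℝ (z.1.2.1 z.2) (z.1.1 z.2) : ℝ) := by fun_prop
    exact (isOpen_lt hc1 hc2).mem_nhds (x := ((L₀, N₀, c₀), w)) hlt
  filter_upwards [(hL.prodMk_nhds (hN.prodMk_nhds hc)).eventually hopen, hinj, hs] with q h1 h2 h3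
  obtain ⟨w, hw, hweq, -⟩ := exists_rayleigh_min hn h2 h3
  have h4 := h1 w (by simpa using hw)
  rw [hweq] at h4
  exact lt_of_mul_lt_mul_right h4 (by positivity)

/-- Upper semicontinuity of the smallest principal curvature. -/
theorem eventually_sInf_spectrum_lt (hn : 1 ≤ n) {c : T → ℝ} {c₀ : ℝ}
    (hL : Tendsto L l (𝓝 L₀)) (hN : Tendsto N l (𝓝 N₀)) (hc : Tendsto c l (𝓝 c₀))
    (hinj₀ : Function.Injective L₀)
    (hs₀ : ∀ x y, inner ℝ (N₀ x) (L₀ y) = inner ℝ (N₀ y) (L₀ x))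
    (hinj : ∀ᶠ q in l, Function.Injective (L q))
    (hs : ∀ᶠ q in l, ∀ x y, inner ℝ (N q x) (L q y) = inner ℝ (N q y) (L q x))
    (h : sInf (spectrum ℝ (shapeMatrix L₀ N₀)) < c₀) :
    ∀ᶠ q in l, sInf (spectrum ℝ (shapeMatrix (L q) (N q))) < c q := by
  obtain ⟨w, hw, hweq, -⟩ := exists_rayleigh_min hn hinj₀ hs₀
  have hw0 : L₀ w ≠ 0 := by
    intro h0
    have : w = 0 := hinj₀ (by rw [h0, map_zero])
    simp [this] at hw
  -- For the upper bound a single test vector suffices, the minimiser of the limiting quotient.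
  have hopen : ∀ᶠ p : (Eucl n →L[ℝ] V) × (Eucl n →L[ℝ] V) × ℝ in 𝓝 (L₀, N₀, c₀),
      inner ℝ (p.2.1 w) (p.1 w) < p.2.2 * ‖p.1 w‖ ^ 2 := by
    refine (isOpen_lt (by fun_prop) (by fun_prop)).mem_nhds ?_
    simp only [Set.mem_ofPred_eq, hweq]
    exact mul_lt_mul_of_pos_right h (by positivity)
  filter_upwards [(hL.prodMk_nhds (hN.prodMk_nhds hc)).eventually hopen, hinj, hs] with q h1 h2 h3
  obtain ⟨-, -, -, hmin⟩ := exists_rayleigh_min hn h2 h3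
  exact lt_of_mul_lt_mul_right (lt_of_le_of_lt (hmin w) h1) (by positivity)

end Continuity

/-! ### Commuting directional derivatives -/

section DirectionalDerivative

variable {F G V : Type*} [NormedAddCommGroup F] [NormedSpace ℝ F] [NormedAddCommGroup G]
  [NormedSpace ℝ G] [NormedAddCommGroup V] [InnerProductSpace ℝ V] {q : F}

/-- The derivative of `f` in the constant direction `w`. -/
noncomputable def dirDeriv (w : F) (f : F → G) : F → G := fun y => fderiv ℝ f y w

theorem _root_.ContDiffAt.dirDeriv {f : F → G} (hf : ContDiffAt ℝ ∞ f q) (w : F) :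
    ContDiffAt ℝ ∞ (dirDeriv w f) q :=
  (hf.fderiv_right (m := ∞) (by simp)).clm_apply contDiffAt_const

theorem _root_.Filter.EventuallyEq.dirDeriv {f g : F → G} (h : f =ᶠ[𝓝 q] g) (w : F) :
    PinchedMCF.dirDeriv w f =ᶠ[𝓝 q] PinchedMCF.dirDeriv w g := by
  filter_upwards [h.fderiv (𝕜 := ℝ)] with y hy
  simp only [PinchedMCF.dirDeriv, hy]

theorem eventually_differentiableAt {f : F → G} (hf : ContDiffAt ℝ ∞ f q) :
    ∀ᶠ y in 𝓝 q, DifferentiableAt ℝ f y := by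
  have h1 : ContDiffAt ℝ 1 f q := hf.of_le (by exact_mod_cast le_top)
  filter_upwards [h1.eventually (by simp)] with y hy
  exact hy.differentiableAt (by simp)

theorem dirDeriv_comm {f : F → G} (hf : ContDiffAt ℝ ∞ f q) (v w : F) :
    dirDeriv v (dirDeriv w f) =ᶠ[𝓝 q] dirDeriv w (dirDeriv v f) := by
  have h2 : ContDiffAt ℝ 2 f q := hf.of_le (WithTop.coe_le_coe.2 (le_top : (2 : ℕ∞) ≤ ⊤))
  filter_upwards [h2.eventually (by simp)] with y hy
  have hd : DifferentiableAt ℝ (fderiv ℝ f) y :=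
    (hy.fderiv_right (m := 1) (by norm_num)).differentiableAt (by simp)
  have key : ∀ a b : F, dirDeriv a (dirDeriv b f) y = fderiv ℝ (fderiv ℝ f) y a b := by
    intro a b
    unfold dirDeriv
    rw [fderiv_clm_apply hd (by fun_prop)]
    simp
  rw [key, key]
  exact (hy.isSymmSndFDerivAt (by simp)).eq v w

theorem dirDeriv_comm_three {f : F → G} (hf : ContDiffAt ℝ ∞ f q) (t v : F) :
    dirDeriv t (dirDeriv v (dirDeriv v f)) q = dirDeriv v (dirDeriv v (dirDeriv t f)) q := by
  rw [(dirDeriv_comm (hf.dirDeriv v) t v).eq_of_nhds,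
    ((dirDeriv_comm hf t v).dirDeriv v).eq_of_nhds]

/-- Applied to the height function in graph coordinates, this takes the place of Simons' identity:
it exchanges the Laplacian of `A(v,v)` with the second derivative of `H` along `v`, at top order. -/
theorem dirDeriv_comm_four {f : F → G} (hf : ContDiffAt ℝ ∞ f q) (k v : F) :
    dirDeriv k (dirDeriv k (dirDeriv v (dirDeriv v f))) q =
      dirDeriv v (dirDeriv v (dirDeriv k (dirDeriv k f))) q := by
  have h : dirDeriv k (dirDeriv v (dirDeriv v f)) =ᶠ[𝓝 q]
      dirDeriv v (dirDeriv v (dirDeriv k f)) :=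
    (dirDeriv_comm (hf.dirDeriv v) k v).trans ((dirDeriv_comm hf k v).dirDeriv v)
  rw [(h.dirDeriv k).eq_of_nhds, dirDeriv_comm_three (hf.dirDeriv k)]

theorem dirDeriv_inner {f g : F → V} (hf : DifferentiableAt ℝ f q) (hg : DifferentiableAt ℝ g q)
    (w : F) : dirDeriv w (fun y => (inner ℝ (f y) (g y) : ℝ)) q =
      inner ℝ (f q) (dirDeriv w g q) + inner ℝ (dirDeriv w f q) (g q) :=
  fderiv_inner_apply ℝ hf hg w

theorem dirDeriv_inner_const {f : F → V} (hf : DifferentiableAt ℝ f q) (c : V) (w : F) :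
    dirDeriv w (fun y => (inner ℝ (f y) c : ℝ)) q = inner ℝ (dirDeriv w f q) c := by
  rw [dirDeriv_inner hf (by fun_prop)]
  simp [dirDeriv]

theorem hasDerivAt_line {f : F → G} (w : F) {s : ℝ} (hf : DifferentiableAt ℝ f (q + s • w)) :
    HasDerivAt (fun s : ℝ => f (q + s • w)) (dirDeriv w f (q + s • w)) s := by
  have h : HasDerivAt (fun s : ℝ => q + s • w) w s := by
    simpa using ((hasDerivAt_id s).smul_const w).const_add q
  exact hf.hasFDerivAt.comp_hasDerivAt s h

end DirectionalDerivative

/-! ### Second-order jets on a line and one-variable derivative tests -/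

section Jets

/-- `f` is twice differentiable at `0` with value and derivatives `a`, `b`, `c`. -/
def HasJet (f : ℝ → ℝ) (a b c : ℝ) : Prop :=
  ∃ f' : ℝ → ℝ, (∀ᶠ s in 𝓝 0, HasDerivAt f (f' s) s) ∧ f 0 = a ∧ f' 0 = b ∧ HasDerivAt f' c 0

namespace HasJet

variable {f g : ℝ → ℝ} {a b c a' b' c' : ℝ}

theorem value (hf : HasJet f a b c) : f 0 = a := by
  obtain ⟨f', -, h, -⟩ := hf
  exact h

theorem hasDerivAt (hf : HasJet f a b c) : HasDerivAt f b 0 := by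
  obtain ⟨f', h, -, rfl, -⟩ := hf
  exact h.self_of_nhds

theorem congr (hf : HasJet f a b c) (h : f =ᶠ[𝓝 0] g) : HasJet g a b c := by
  obtain ⟨f', h1, h2, h3, h4⟩ := hf
  refine ⟨f', ?_, h.eq_of_nhds ▸ h2, h3, h4⟩
  filter_upwards [h1, h.eventuallyEq_nhds] with s hs hs'
  exact hs.congr_of_eventuallyEq hs'.symm

theorem cast (hf : HasJet f a b c) (ha : a = a') (hb : b = b') (hc : c = c') :
    HasJet f a' b' c' := by
  subst ha hb hc; exact hf

/-- Two expressions for the same function can be compared coefficient by coefficient; this is how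
identities between derivatives are extracted below. -/
theorem unique (hf : HasJet f a b c) (hg : HasJet f a' b' c') : b = b' ∧ c = c' := by
  obtain ⟨f', h1, h2, h3, h4⟩ := hf
  obtain ⟨g', k1, k2, k3, k4⟩ := hg
  have h : f' =ᶠ[𝓝 0] g' := by
    filter_upwards [h1, k1] with s hs ks using hs.unique ks
  exact ⟨by rw [← h3, ← k3, h.eq_of_nhds], h4.unique (k4.congr_of_eventuallyEq h)⟩

theorem const (a : ℝ) : HasJet (fun _ => a) a 0 0 :=
  ⟨fun _ => 0, .of_forall fun s => hasDerivAt_const s a, rfl, rfl, hasDerivAt_const _ _⟩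

theorem add (hf : HasJet f a b c) (hg : HasJet g a' b' c') :
    HasJet (fun s => f s + g s) (a + a') (b + b') (c + c') := by
  obtain ⟨f', h1, h2, h3, h4⟩ := hf
  obtain ⟨g', k1, k2, k3, k4⟩ := hg
  refine ⟨fun s => f' s + g' s, ?_, by simp only [h2, k2], by simp only [h3, k3], h4.add k4⟩
  filter_upwards [h1, k1] with s hs ks using hs.add ks

theorem mul (hf : HasJet f a b c) (hg : HasJet g a' b' c') :
    HasJet (fun s => f s * g s) (a * a') (b * a' + a * b') (c * a' + 2 * b * b' + a * c') := by
  have hf0 := hf.hasDerivAt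
  have hg0 := hg.hasDerivAt
  obtain ⟨f', h1, h2, h3, h4⟩ := hf
  obtain ⟨g', k1, k2, k3, k4⟩ := hg
  refine ⟨fun s => f' s * g s + f s * g' s, ?_, by simp only [h2, k2], by simp only [h2, h3, k2, k3], ?_⟩
  · filter_upwards [h1, k1] with s hs ks using hs.mul ks
  · refine ((h4.mul hg0).add (hf0.mul k4)).congr_deriv ?_
    rw [h2, h3, k2, k3]; ring

theorem const_mul (r : ℝ) (hf : HasJet f a b c) :
    HasJet (fun s => r * f s) (r * a) (r * b) (r * c) :=
  ((const r).mul hf).cast rfl (by ring) (by ring)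

theorem sub (hf : HasJet f a b c) (hg : HasJet g a' b' c') :
    HasJet (fun s => f s - g s) (a - a') (b - b') (c - c') :=
  ((hf.add (hg.const_mul (-1))).congr (.of_forall fun s => by ring)).cast
    (by ring) (by ring) (by ring)

theorem sum {ι : Type*} (S : Finset ι) {f : ι → ℝ → ℝ} {a b c : ι → ℝ}
    (h : ∀ i, HasJet (f i) (a i) (b i) (c i)) :
    HasJet (fun s => ∑ i ∈ S, f i s) (∑ i ∈ S, a i) (∑ i ∈ S, b i) (∑ i ∈ S, c i) := by
  classical
  induction S using Finset.induction_on with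
  | empty => simpa using const 0
  | insert i S hi ih => simpa only [Finset.sum_insert hi] using (h i).add ih

theorem inv_sqrt_one_add (hf : HasJet f 0 0 c) :
    HasJet (fun s => (√(1 + f s))⁻¹) 1 0 (-c / 2) := by
  have hf0 := hf.hasDerivAt
  obtain ⟨f', h1, h2, h3, h4⟩ := hf
  have hpos : ∀ᶠ s in 𝓝 0, 0 < 1 + f s := by
    have : Tendsto (fun s => 1 + f s) (𝓝 0) (𝓝 (1 + f 0)) :=
      (hf0.continuousAt.const_add 1 : ContinuousAt (fun s => 1 + f s) 0)
    exact this.eventually (lt_mem_nhds (by rw [h2]; norm_num))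
  -- With `y = (1 + f)^{-1/2}` this reads `y' = -f' y³ / 2`. The right side contains only `f'` and
  -- `y`, so it can be differentiated again at `0`.
  have hd : ∀ᶠ s in 𝓝 0, HasDerivAt (fun s => (√(1 + f s))⁻¹)
      (-(f' s / 2) * ((√(1 + f s))⁻¹ * ((√(1 + f s))⁻¹ * (√(1 + f s))⁻¹))) s := by
    filter_upwards [hpos, h1] with s hs hd
    refine (((hd.const_add 1).sqrt hs.ne').inv (Real.sqrt_pos.2 hs).ne').congr_deriv ?_
    have := (Real.sqrt_pos.2 hs).ne'
    field_simp
  refine ⟨_, hd, by simp [h2], by simp [h3], ?_⟩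
  have h0 := hd.self_of_nhds
  refine (((h4.div_const 2).neg).mul (h0.mul (h0.mul h0))).congr_deriv ?_
  simp only [Pi.mul_apply, Pi.neg_apply, h2, h3]
  simp
  ring

/-- If `c` were negative, the second derivative test would make `0` a local maximum as well as a
local minimum. Then `f` would vanish near `0`, forcing `c = 0`. -/
theorem second_nonneg (hf : HasJet f 0 b c) (h : ∀ᶠ s in 𝓝 0, 0 ≤ f s) : 0 ≤ c := by
  by_contra hc
  push Not at hc
  have hmin : IsLocalMin f 0 := by
    filter_upwards [h] with s hs
    rwa [hf.value]
  have hb : b = 0 := hmin.hasDerivAt_eq_zero hf.hasDerivAt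
  have hf' := hf
  obtain ⟨f', h1, h2, h3, h4⟩ := hf
  have hderiv : deriv (fun s => -f s) =ᶠ[𝓝 0] fun s => -f' s := by
    filter_upwards [h1] with s hs using hs.neg.deriv
  have hmax : IsLocalMin (fun s => -f s) 0 := by
    refine isLocalMin_of_deriv_deriv_pos ?_ ?_ ?_
    · have h5 : HasDerivAt (fun s => -f' s) (-c) 0 := h4.neg
      rw [hderiv.deriv_eq, h5.deriv]; linarith
    · rw [hderiv.eq_of_nhds, h3, hb, neg_zero]
    · exact h1.self_of_nhds.continuousAt.neg
  have hzero : f =ᶠ[𝓝 0] fun _ => 0 := by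
    filter_upwards [h, hmax] with s hs hs'
    simp only [h2] at hs'
    linarith
  have := (hf'.congr hzero).unique (const 0)
  linarith [this.2]

theorem of_contDiffAt {F : Type*} [NormedAddCommGroup F] [NormedSpace ℝ F] {f : F → ℝ} {q : F}
    (hf : ContDiffAt ℝ ∞ f q) (w : F) :
    HasJet (fun s => f (q + s • w)) (f q) (dirDeriv w f q) (dirDeriv w (dirDeriv w f) q) := by
  have hcont : Tendsto (fun s : ℝ => q + s • w) (𝓝 0) (𝓝 q) := by
    have : Continuous fun s : ℝ => q + s • w := by fun_prop
    simpa using this.tendsto 0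
  refine ⟨fun s => dirDeriv w f (q + s • w), ?_, by simp, by simp, ?_⟩
  · filter_upwards [hcont.eventually (eventually_differentiableAt hf)] with s hs
    exact hasDerivAt_line w hs
  · have h := hasDerivAt_line (q := q) (s := 0) (f := dirDeriv w f) w
      (by simpa using (hf.dirDeriv w).differentiableAt (by simp))
    simpa using h

end HasJet

/-- A product with a factor that vanishes is differentiable if the other factor is continuous. -/
theorem hasDerivAt_mul_of_eq_zero {x y : ℝ → ℝ} {x' t : ℝ} (hx : HasDerivAt x x' t)
    (h0 : x t = 0) (hy : ContinuousAt y t) : HasDerivAt (fun s => x s * y s) (x' * y t) t := by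
  rw [hasDerivAt_iff_tendsto_slope] at hx ⊢
  have := hx.mul (hy.tendsto.mono_left (nhdsWithin_le_nhds (s := {t}ᶜ)))
  refine this.congr fun s => ?_
  simp only [slope_def_field, h0]
  ring

/-- Difference quotients from the left are nonpositive. Only past times are used, since the touching
time may be the last at which the barrier inequality is known. -/
theorem hasDerivAt_nonpos_of_eventually {f : ℝ → ℝ} {f' t : ℝ} (hf : HasDerivAt f f' t)
    (h0 : f t = 0) (h : ∀ᶠ s in 𝓝 t, s ≤ t → 0 ≤ f s) : f' ≤ 0 := by
  have h1 := (hasDerivAt_iff_tendsto_slope.1 hf).mono_left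
    (nhdsWithin_mono t (s := Set.Iio t) fun s hs => ne_of_lt hs)
  refine le_of_tendsto h1 ?_
  filter_upwards [nhdsWithin_le_nhds h, self_mem_nhdsWithin] with s hs hst
  rw [slope_def_field, h0, sub_zero]
  exact div_nonpos_of_nonneg_of_nonpos (hs (le_of_lt hst)) (by linarith [Set.mem_Iio.1 hst])

end Jets

/-! ### Geometry of a flow whose central slice is a graph over its tangent plane -/

section GraphFlow

variable {n : ℕ} {V : Type*} [NormedAddCommGroup V] [InnerProductSpace ℝ V]

/-- A coordinate direction in space-time tangent to the time slices. -/
abbrev spaceDir (w : Eucl n) : Eucl n × ℝ := (w, 0)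

/-- The time direction in space-time. -/
abbrev timeDir (n : ℕ) : Eucl n × ℝ := (0, 1)

/-- The standard basis vectors of `ℝⁿ`. -/
noncomputable abbrev stdVec (i : Fin n) : Eucl n := EuclideanSpace.single i (1 : ℝ)

/-- The differential in the space variables of a map on space-time. -/
noncomputable def sliceDeriv (Y : Eucl n × ℝ → V) (q : Eucl n × ℝ) : Eucl n →L[ℝ] V :=
  (fderiv ℝ Y q).comp (ContinuousLinearMap.inl ℝ (Eucl n) ℝ)

theorem sliceDeriv_apply (Y : Eucl n × ℝ → V) (q : Eucl n × ℝ) (w : Eucl n) :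
    sliceDeriv Y q w = dirDeriv (spaceDir w) Y q := rfl

/-- The mean curvature of the slices of a parametrised family of hypersurfaces. -/
noncomputable def sliceMean (Y N : Eucl n × ℝ → V) (q : Eucl n × ℝ) : ℝ :=
  (shapeMatrix (sliceDeriv Y q) (sliceDeriv N q)).trace

/-- A parametrised mean curvature flow near `(0, t₀)` which at time `t₀` is the graph of a function
over the tangent plane `p + range J` at its centre. -/
structure IsGraphFlow (Y N : Eucl n × ℝ → V) (t₀ : ℝ) (J : Eucl n →ₗᵢ[ℝ] V) (ν₀ p : V) :
    Prop where
  smooth : ContDiffAt ℝ ∞ Y (0, t₀)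
  normal_smooth : ContDiffAt ℝ ∞ N (0, t₀)
  normal_zero : N (0, t₀) = ν₀
  norm_normal : ∀ᶠ q in 𝓝 ((0 : Eucl n), t₀), ‖N q‖ = 1
  orthogonal : ∀ᶠ q in 𝓝 ((0 : Eucl n), t₀), ∀ w,
    inner ℝ (dirDeriv (spaceDir w) Y q) (N q) = 0
  evolves : ∀ᶠ q in 𝓝 ((0 : Eucl n), t₀), dirDeriv (timeDir n) Y q = -(sliceMean Y N q) • N q
  graph : ∀ᶠ y in 𝓝 (0 : Eucl n), ∀ w, inner ℝ (Y (y, t₀)) (J w) = inner ℝ p (J w) + inner ℝ y w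
  decomp : ∀ z, z = J (∑ i, (inner ℝ z (J (stdVec i)) : ℝ) • stdVec i) + (inner ℝ z ν₀ : ℝ) • ν₀

/-- The height of the slices below the tangent plane. -/
noncomputable def height (Y : Eucl n × ℝ → V) (ν₀ : V) (q : Eucl n × ℝ) : ℝ := -inner ℝ (Y q) ν₀

theorem tendsto_slice (t₀ : ℝ) :
    Tendsto (fun y : Eucl n => (y, t₀)) (𝓝 0) (𝓝 ((0 : Eucl n), t₀)) := by
  have : Continuous fun y : Eucl n => (y, t₀) := by fun_prop
  exact this.tendsto 0

theorem tendsto_line (w : Eucl n) : Tendsto (fun s : ℝ => s • w) (𝓝 0) (𝓝 (0 : Eucl n)) := by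
  have : Continuous fun s : ℝ => s • w := by fun_prop
  simpa using this.tendsto 0

theorem slice_add (y w : Eucl n) (t s : ℝ) : (y, t) + s • spaceDir w = (y + s • w, t) := by
  simp [spaceDir]

theorem eventually_dirDeriv_differentiableAt {F G : Type*} [NormedAddCommGroup F]
    [NormedSpace ℝ F] [NormedAddCommGroup G] [NormedSpace ℝ G] {f : F → G} {q : F}
    (hf : ContDiffAt ℝ ∞ f q) :
    ∀ᶠ y in 𝓝 q, ∀ w, DifferentiableAt ℝ (dirDeriv w f) y := by
  filter_upwards [eventually_differentiableAt (hf.fderiv_right (m := ∞) (by simp))] with y hy w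
  exact hy.clm_apply (differentiableAt_const w)

/-- If `f` is eventually equal along the slice to a function of `y`, so are the derivatives. -/
theorem dirDeriv_slice_eq {f : Eucl n × ℝ → ℝ} {g : Eucl n → ℝ} {t₀ g' : ℝ} {y w : Eucl n}
    (hf : DifferentiableAt ℝ f (y, t₀)) (h : ∀ᶠ z in 𝓝 y, f (z, t₀) = g z)
    (hg : HasDerivAt (fun s : ℝ => g (y + s • w)) g' 0) :
    dirDeriv (spaceDir w) f (y, t₀) = g' := by
  have h1 := hasDerivAt_line (q := (y, t₀)) (s := 0) (f := f) (spaceDir w) (by simpa using hf)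
  simp only [slice_add] at h1
  have hc : Tendsto (fun s : ℝ => y + s • w) (𝓝 0) (𝓝 y) := by
    have : Continuous fun s : ℝ => y + s • w := by fun_prop
    simpa using this.tendsto 0
  have h2 := h1.congr_of_eventuallyEq (f₁ := fun s : ℝ => g (y + s • w)) (by
    filter_upwards [hc.eventually h] with s hs using hs.symm)
  simpa using h2.unique hg

namespace IsGraphFlow

variable {Y N : Eucl n × ℝ → V} {t₀ : ℝ} {J : Eucl n →ₗᵢ[ℝ] V} {ν₀ p : V}

theorem height_contDiffAt (h : IsGraphFlow Y N t₀ J ν₀ p) :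
    ContDiffAt ℝ ∞ (height Y ν₀) (0, t₀) :=
  (h.smooth.inner ℝ contDiffAt_const).neg

theorem norm_normal_zero (h : IsGraphFlow Y N t₀ J ν₀ p) : ‖ν₀‖ = 1 := by
  rw [← h.normal_zero]; exact h.norm_normal.self_of_nhds

theorem dirDeriv_height (h : IsGraphFlow Y N t₀ J ν₀ p) :
    ∀ᶠ q in 𝓝 ((0 : Eucl n), t₀), ∀ w,
      dirDeriv w (height Y ν₀) q = -inner ℝ (dirDeriv w Y q) ν₀ := by
  filter_upwards [eventually_differentiableAt h.smooth] with q hq w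
  rw [← dirDeriv_inner_const hq]
  have h1 : height Y ν₀ = fun q => -(inner ℝ (Y q) ν₀ : ℝ) := rfl
  simp only [dirDeriv, h1, fderiv_fun_neg]
  rfl

theorem dirDeriv_dirDeriv_height (h : IsGraphFlow Y N t₀ J ν₀ p) :
    ∀ᶠ q in 𝓝 ((0 : Eucl n), t₀), ∀ v w,
      dirDeriv v (dirDeriv w (height Y ν₀)) q = -inner ℝ (dirDeriv v (dirDeriv w Y) q) ν₀ := by
  filter_upwards [eventually_dirDeriv_differentiableAt h.smooth,
    h.dirDeriv_height.eventually_nhds] with q hq hq' v w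
  have h1 : dirDeriv w (height Y ν₀) =ᶠ[𝓝 q] fun y => -inner ℝ (dirDeriv w Y y) ν₀ := by
    filter_upwards [hq'] with y hy using hy w
  rw [(h1.dirDeriv v).eq_of_nhds, ← dirDeriv_inner_const (hq w)]
  simp only [dirDeriv]
  rw [fderiv_fun_neg]; rfl

theorem inner_dirDeriv (h : IsGraphFlow Y N t₀ J ν₀ p) :
    ∀ᶠ y in 𝓝 (0 : Eucl n), ∀ w x, inner ℝ (dirDeriv (spaceDir w) Y (y, t₀)) (J x) = inner ℝ w x := by
  filter_upwards [(tendsto_slice t₀).eventually (eventually_differentiableAt h.smooth),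
    h.graph.eventually_nhds] with y hy hg w x
  rw [← dirDeriv_inner_const hy]
  refine dirDeriv_slice_eq (g := fun y => inner ℝ p (J x) + inner ℝ y x)
    (hy.inner ℝ (differentiableAt_const _))
    (by filter_upwards [hg] with z hz using hz x) ?_
  have : (fun s : ℝ => inner ℝ p (J x) + inner ℝ (y + s • w) x) =
      fun s : ℝ => (inner ℝ p (J x) + inner ℝ y x) + s * inner ℝ w x := by
    ext s; rw [inner_add_left, real_inner_smul_left]; ring
  rw [this]
  simpa using ((hasDerivAt_id (0 : ℝ)).mul_const (inner ℝ w x : ℝ)).const_add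
    ((inner ℝ p (J x) : ℝ) + inner ℝ y x)

/-- Along the central slice the tangential components of `Y` are affine in `y`, so second space
derivatives have no tangential part. -/
theorem inner_dirDeriv_dirDeriv (h : IsGraphFlow Y N t₀ J ν₀ p) :
    ∀ᶠ y in 𝓝 (0 : Eucl n), ∀ v w x,
      inner ℝ (dirDeriv (spaceDir v) (dirDeriv (spaceDir w) Y) (y, t₀)) (J x) = 0 := by
  filter_upwards [(tendsto_slice t₀).eventually (eventually_dirDeriv_differentiableAt h.smooth),
    h.inner_dirDeriv.eventually_nhds] with y hy hg v w x
  have hd := hy (spaceDir w)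
  rw [← dirDeriv_inner_const hd]
  refine dirDeriv_slice_eq (g := fun y => inner ℝ w x) (hd.inner ℝ (differentiableAt_const _))
    (by filter_upwards [hg] with z hz using hz w x) (hasDerivAt_const _ _)

theorem dirDeriv_eq (h : IsGraphFlow Y N t₀ J ν₀ p) :
    ∀ᶠ y in 𝓝 (0 : Eucl n), ∀ w, dirDeriv (spaceDir w) Y (y, t₀) =
      J w - dirDeriv (spaceDir w) (height Y ν₀) (y, t₀) • ν₀ := by
  filter_upwards [h.inner_dirDeriv, (tendsto_slice t₀).eventually h.dirDeriv_height] with y h1 h2 w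
  rw [h2, neg_smul, sub_neg_eq_add]
  conv_lhs => rw [h.decomp (dirDeriv (spaceDir w) Y (y, t₀))]
  simp only [h1]
  congr 2
  conv_rhs => rw [eucl_eq_sum w]
  simp [stdVec, EuclideanSpace.inner_single_right]

theorem dirDeriv_dirDeriv_eq (h : IsGraphFlow Y N t₀ J ν₀ p) :
    ∀ᶠ y in 𝓝 (0 : Eucl n), ∀ v w, dirDeriv (spaceDir v) (dirDeriv (spaceDir w) Y) (y, t₀) =
      -(dirDeriv (spaceDir v) (dirDeriv (spaceDir w) (height Y ν₀)) (y, t₀) • ν₀) := by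
  filter_upwards [h.inner_dirDeriv_dirDeriv,
    (tendsto_slice t₀).eventually h.dirDeriv_dirDeriv_height] with y h1 h2 v w
  rw [h2, neg_smul, neg_neg]
  conv_lhs => rw [h.decomp (dirDeriv (spaceDir v) (dirDeriv (spaceDir w) Y) (y, t₀))]
  simp [h1]

theorem dirDeriv_height_zero (h : IsGraphFlow Y N t₀ J ν₀ p) (w : Eucl n) :
    dirDeriv (spaceDir w) (height Y ν₀) (0, t₀) = 0 := by
  rw [h.dirDeriv_height.self_of_nhds, ← h.normal_zero, h.orthogonal.self_of_nhds, neg_zero]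

theorem dirDeriv_zero (h : IsGraphFlow Y N t₀ J ν₀ p) (w : Eucl n) :
    dirDeriv (spaceDir w) Y (0, t₀) = J w := by
  rw [h.dirDeriv_eq.self_of_nhds, h.dirDeriv_height_zero, zero_smul, sub_zero]

theorem inner_isometry_normal (h : IsGraphFlow Y N t₀ J ν₀ p) (w : Eucl n) :
    inner ℝ (J w) ν₀ = 0 := by
  rw [← h.dirDeriv_zero, ← h.normal_zero, h.orthogonal.self_of_nhds]

/-- The normal is orthogonal to `J w - u_w ν₀`, where `u` is the height, so its tangential part is
`⟨N, ν₀⟩` times the gradient of `u`. -/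
theorem inner_normal_isometry (h : IsGraphFlow Y N t₀ J ν₀ p) :
    ∀ᶠ y in 𝓝 (0 : Eucl n), ∀ w, inner ℝ (N (y, t₀)) (J w) =
      inner ℝ (N (y, t₀)) ν₀ * dirDeriv (spaceDir w) (height Y ν₀) (y, t₀) := by
  filter_upwards [h.dirDeriv_eq, (tendsto_slice t₀).eventually h.orthogonal] with y h1 h2 w
  have := h2 w
  rw [h1, inner_sub_left, real_inner_smul_left, real_inner_comm, real_inner_comm (N _) ν₀] at this
  linarith

/-- The cosine of the angle between the slice and the tangent plane. -/
theorem inner_normal_normal (h : IsGraphFlow Y N t₀ J ν₀ p) :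
    ∀ᶠ y in 𝓝 (0 : Eucl n), inner ℝ (N (y, t₀)) ν₀ =
      (√(1 + ∑ i, dirDeriv (spaceDir (stdVec i)) (height Y ν₀) (y, t₀) *
        dirDeriv (spaceDir (stdVec i)) (height Y ν₀) (y, t₀)))⁻¹ := by
  have hcont : ContinuousAt N (0, t₀) := h.normal_smooth.continuousAt
  have hpos : ∀ᶠ y in 𝓝 (0 : Eucl n), 0 < inner ℝ (N (y, t₀)) ν₀ := by
    have h1 : Tendsto (fun y : Eucl n => (inner ℝ (N (y, t₀)) ν₀ : ℝ)) (𝓝 0) (𝓝 (inner ℝ ν₀ ν₀)) := by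
      have := (hcont.tendsto.comp (tendsto_slice t₀)).inner (𝕜 := ℝ) (tendsto_const_nhds (x := ν₀))
      rwa [h.normal_zero] at this
    refine h1.eventually (lt_mem_nhds ?_)
    rw [real_inner_self_eq_norm_sq, h.norm_normal_zero]; norm_num
  filter_upwards [hpos, h.inner_normal_isometry, (tendsto_slice t₀).eventually h.norm_normal]
    with y h1 h2 h3
  set θ : ℝ := inner ℝ (N (y, t₀)) ν₀
  set S := ∑ i, dirDeriv (spaceDir (stdVec i)) (height Y ν₀) (y, t₀) *
    dirDeriv (spaceDir (stdVec i)) (height Y ν₀) (y, t₀) with hS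
  have hS0 : 0 ≤ S := Finset.sum_nonneg fun i _ => mul_self_nonneg _
  -- This is `|N|² = 1`, expanded into the component along `ν₀` and the tangential ones, each `θ`
  -- times a partial derivative of the height.
  have key : θ ^ 2 * (1 + S) = 1 := by
    have h4 : (inner ℝ (N (y, t₀)) (N (y, t₀)) : ℝ) = θ ^ 2 * (1 + S) := by
      have h5 := congrArg (fun z => (inner ℝ (N (y, t₀)) z : ℝ)) (h.decomp (N (y, t₀)))
      simp only [inner_add_right, map_sum, map_smul, inner_sum, real_inner_smul_right, h2] at h5
      rw [h5, hS, mul_add, Finset.mul_sum, add_comm]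
      congr 1
      · change θ * θ = _
        ring
      · exact Finset.sum_congr rfl fun i _ => by ring
    rw [← h4, real_inner_self_eq_norm_sq, h3]; norm_num
  rw [← Real.sqrt_inv, eq_comm, Real.sqrt_eq_iff_mul_self_eq (by positivity) h1.le]
  field_simp
  linarith

/-- The second fundamental form in terms of second derivatives. -/
theorem inner_dirDeriv_normal (h : IsGraphFlow Y N t₀ J ν₀ p) :
    ∀ᶠ q in 𝓝 ((0 : Eucl n), t₀), ∀ v w : Eucl n,
      inner ℝ (dirDeriv (spaceDir v) N q) (dirDeriv (spaceDir w) Y q) =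
        -inner ℝ (N q) (dirDeriv (spaceDir v) (dirDeriv (spaceDir w) Y) q) := by
  filter_upwards [eventually_dirDeriv_differentiableAt h.smooth,
    eventually_differentiableAt h.normal_smooth, h.orthogonal.eventually_nhds] with q h1 h2 h3 v w
  have h4 := dirDeriv_inner (h1 (spaceDir w)) h2 (spaceDir v)
  have h5 : (fun y => (inner ℝ (dirDeriv (spaceDir w) Y y) (N y) : ℝ)) =ᶠ[𝓝 q] fun _ => 0 := by
    filter_upwards [h3] with y hy using hy w
  rw [(h5.dirDeriv (spaceDir v)).eq_of_nhds] at h4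
  have h6 : dirDeriv (spaceDir v) (fun _ : Eucl n × ℝ => (0 : ℝ)) q = 0 := by simp [dirDeriv]
  rw [h6, real_inner_comm, real_inner_comm (N q)] at h4
  linarith

end IsGraphFlow

end GraphFlow

/-! ### Second-order expansion of the mean curvature of a graph -/

section MeanCurvatureJet

variable {n : ℕ} {V : Type*} [NormedAddCommGroup V] [InnerProductSpace ℝ V]

/-- The mean curvature of a graph with gradient `a` and Hessian `U`. -/
theorem trace_graph {a : Fin n → ℝ} {U : Matrix (Fin n) (Fin n) ℝ} {θ : ℝ}
    (hθ : θ ^ 2 * (1 + ∑ i, a i * a i) = 1) :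
    ((1 + Matrix.vecMulVec a a)⁻¹ * (θ • U)).trace =
      θ * (∑ i, U i i - θ * θ * ∑ i, ∑ j, U i j * (a i * a j)) := by
  have hsq : Matrix.vecMulVec a a * Matrix.vecMulVec a a =
      (∑ i, a i * a i) • Matrix.vecMulVec a a := by
    ext i j
    simp only [Matrix.mul_apply, Matrix.vecMulVec_apply, Matrix.smul_apply, smul_eq_mul,
      Finset.sum_mul]
    exact Finset.sum_congr rfl fun k _ => by ring
  -- The Sherman–Morrison formula, with `θ² = 1 / (1 + |a|²)`.
  have hinv : (1 + Matrix.vecMulVec a a)⁻¹ = 1 - θ ^ 2 • Matrix.vecMulVec a a := by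
    refine Matrix.inv_eq_right_inv ?_
    rw [add_mul, mul_sub, mul_sub, Matrix.mul_smul, Matrix.mul_smul, hsq, smul_smul]
    simp only [one_mul, mul_one]
    have : (1 : Matrix (Fin n) (Fin n) ℝ) - θ ^ 2 • Matrix.vecMulVec a a +
        (Matrix.vecMulVec a a - (θ ^ 2 * ∑ i, a i * a i) • Matrix.vecMulVec a a) =
        1 + (1 - θ ^ 2 * (1 + ∑ i, a i * a i)) • Matrix.vecMulVec a a := by
      module
    rw [this, hθ, sub_self, zero_smul, add_zero]
  rw [hinv, Matrix.mul_smul, Matrix.trace_smul, sub_mul, one_mul, Matrix.trace_sub,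
    Matrix.smul_mul, Matrix.trace_smul, smul_eq_mul, smul_eq_mul, sq]
  congr 3
  simp only [Matrix.trace, Matrix.diag, Matrix.mul_apply, Matrix.vecMulVec_apply]
  rw [Finset.sum_comm]
  exact Finset.sum_congr rfl fun i _ => Finset.sum_congr rfl fun j _ => by ring

namespace IsGraphFlow

variable {Y N : Eucl n × ℝ → V} {t₀ : ℝ} {J : Eucl n →ₗᵢ[ℝ] V} {ν₀ p : V}

/-- The second derivatives at the centre of the height of the central slice. -/
noncomputable def hess (Y : Eucl n × ℝ → V) (ν₀ : V) (t₀ : ℝ) (v w : Eucl n) : ℝ :=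
  dirDeriv (spaceDir v) (dirDeriv (spaceDir w) (height Y ν₀)) (0, t₀)

theorem sliceMean_eq (h : IsGraphFlow Y N t₀ J ν₀ p) :
    ∀ᶠ y in 𝓝 (0 : Eucl n), sliceMean Y N (y, t₀) = inner ℝ (N (y, t₀)) ν₀ *
      (∑ i, dirDeriv (spaceDir (stdVec i)) (dirDeriv (spaceDir (stdVec i)) (height Y ν₀)) (y, t₀) -
        inner ℝ (N (y, t₀)) ν₀ * inner ℝ (N (y, t₀)) ν₀ * ∑ i, ∑ j,
          dirDeriv (spaceDir (stdVec i)) (dirDeriv (spaceDir (stdVec j)) (height Y ν₀)) (y, t₀) *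
          (dirDeriv (spaceDir (stdVec i)) (height Y ν₀) (y, t₀) *
            dirDeriv (spaceDir (stdVec j)) (height Y ν₀) (y, t₀))) := by
  filter_upwards [h.dirDeriv_eq, h.dirDeriv_dirDeriv_eq, h.inner_normal_normal,
    (tendsto_slice t₀).eventually h.inner_dirDeriv_normal] with y h1 h2 h3 h4
  have hS0 : 0 ≤ ∑ i, dirDeriv (spaceDir (stdVec i)) (height Y ν₀) (y, t₀) *
        dirDeriv (spaceDir (stdVec i)) (height Y ν₀) (y, t₀) :=
    Finset.sum_nonneg fun i _ => mul_self_nonneg _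
  have hθ : (inner ℝ (N (y, t₀)) ν₀ : ℝ) ^ 2 *
      (1 + ∑ i, dirDeriv (spaceDir (stdVec i)) (height Y ν₀) (y, t₀) *
        dirDeriv (spaceDir (stdVec i)) (height Y ν₀) (y, t₀)) = 1 := by
    rw [h3, inv_pow, Real.sq_sqrt (by positivity), inv_mul_cancel₀ (by positivity)]
  have hg : pairing (sliceDeriv Y (y, t₀)) (sliceDeriv Y (y, t₀)) =
      1 + Matrix.vecMulVec (fun i => dirDeriv (spaceDir (stdVec i)) (height Y ν₀) (y, t₀))
        (fun i => dirDeriv (spaceDir (stdVec i)) (height Y ν₀) (y, t₀)) := by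
    ext i j
    have hij := congrFun (congrFun (pairing_isometry J) i) j
    simp only [pairing, Matrix.of_apply, LinearIsometry.coe_toContinuousLinearMap] at hij
    simp only [pairing, Matrix.of_apply, sliceDeriv_apply, h1, inner_sub_left, inner_sub_right,
      real_inner_smul_left, real_inner_smul_right, h.inner_isometry_normal, Matrix.add_apply,
      Matrix.vecMulVec_apply, hij, real_inner_comm (J _) ν₀, real_inner_self_eq_norm_sq,
      h.norm_normal_zero]
    ring
  have ha : pairing (sliceDeriv N (y, t₀)) (sliceDeriv Y (y, t₀)) =
      (inner ℝ (N (y, t₀)) ν₀ : ℝ) • Matrix.of fun i j => dirDeriv (spaceDir (stdVec i))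
        (dirDeriv (spaceDir (stdVec j)) (height Y ν₀)) (y, t₀) := by
    ext i j
    simp only [pairing, Matrix.of_apply, sliceDeriv_apply, h4, h2, Matrix.smul_apply, smul_eq_mul,
      inner_neg_right, real_inner_smul_right]
    ring
  rw [sliceMean, shapeMatrix, hg, ha, trace_graph hθ]
  rfl

/-- The gradient of the height vanishes at the centre, so the square under the root vanishes to
first order and its second derivative is `2|A w|²`. -/
theorem hasJet_normal (h : IsGraphFlow Y N t₀ J ν₀ p) (w : Eucl n) :
    HasJet (fun s => inner ℝ (N ((0, t₀) + s • spaceDir w)) ν₀) 1 0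
      (-∑ i, hess Y ν₀ t₀ w (stdVec i) ^ 2) := by
  have hu : ∀ i : Fin n, HasJet
      (fun s => dirDeriv (spaceDir (stdVec i)) (height Y ν₀) ((0, t₀) + s • spaceDir w)) 0
      (hess Y ν₀ t₀ w (stdVec i)) _ := fun i =>
    (HasJet.of_contDiffAt (h.height_contDiffAt.dirDeriv (spaceDir (stdVec i)))
      (spaceDir w)).cast (h.dirDeriv_height_zero _) rfl rfl
  have h1 := HasJet.sum Finset.univ fun i => (hu i).mul (hu i)
  have h2 := (h1.cast (by simp) (by simp) (by
    simp only [mul_zero, zero_mul, zero_add, add_zero]; rfl)).inv_sqrt_one_add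
  refine (h2.congr ?_).cast rfl rfl ?_
  · filter_upwards [(tendsto_line w).eventually h.inner_normal_normal] with s hs
    simp only [slice_add, zero_add]
    exact hs.symm
  · rw [← Finset.sum_neg_distrib, ← Finset.sum_neg_distrib, Finset.sum_div]
    exact Finset.sum_congr rfl fun i _ => by ring

/-- Here `H = θ(Δu - θ² Σ u_ij u_i u_j)` with `θ = ⟨N, ν₀⟩`. Since `Du = 0` at the centre, the last
sum contributes at second order only through the first derivatives of `u_i` and `u_j`. The linear
coefficient `b` may stay unspecified: wherever it occurs below it is multiplied by a vanishing
factor or plays no role in the conclusion. -/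
theorem hasJet_sliceMean (h : IsGraphFlow Y N t₀ J ν₀ p) (w : Eucl n) :
    ∃ b, HasJet (fun s => sliceMean Y N ((0, t₀) + s • spaceDir w))
      (∑ i, hess Y ν₀ t₀ (stdVec i) (stdVec i)) b
      (∑ i, dirDeriv (spaceDir w) (dirDeriv (spaceDir w) (dirDeriv (spaceDir (stdVec i))
          (dirDeriv (spaceDir (stdVec i)) (height Y ν₀)))) (0, t₀)
        - 2 * ∑ i, ∑ j, hess Y ν₀ t₀ (stdVec i) (stdVec j) *
            (hess Y ν₀ t₀ w (stdVec i) * hess Y ν₀ t₀ w (stdVec j))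
        - (∑ i, hess Y ν₀ t₀ (stdVec i) (stdVec i)) * ∑ i, hess Y ν₀ t₀ w (stdVec i) ^ 2) := by
  have hu : ∀ i : Fin n, HasJet
      (fun s => dirDeriv (spaceDir (stdVec i)) (height Y ν₀) ((0, t₀) + s • spaceDir w)) 0
      (hess Y ν₀ t₀ w (stdVec i)) _ := fun i =>
    (HasJet.of_contDiffAt (h.height_contDiffAt.dirDeriv (spaceDir (stdVec i)))
      (spaceDir w)).cast (h.dirDeriv_height_zero _) rfl rfl
  have huu := fun i j : Fin n => HasJet.of_contDiffAt ((h.height_contDiffAt.dirDeriv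
    (spaceDir (stdVec j))).dirDeriv (spaceDir (stdVec i))) (spaceDir w)
  have h1 := HasJet.sum Finset.univ fun i => huu i i
  have h2 := HasJet.sum Finset.univ fun i => HasJet.sum Finset.univ fun j =>
    (huu i j).mul ((hu i).mul (hu j))
  have hθ := h.hasJet_normal w
  have h3 := hθ.mul (h1.sub ((hθ.mul hθ).mul h2))
  refine ⟨_, (h3.congr ?_).cast ?_ rfl ?_⟩
  · filter_upwards [(tendsto_line w).eventually h.sliceMean_eq] with s hs
    simp only [slice_add, zero_add]
    exact hs.symm
  · simp [hess]
  · simp only [mul_zero, zero_mul, zero_add, add_zero, Finset.sum_const_zero, one_mul, mul_one,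
      sub_zero]
    have e1 : ∑ i : Fin n, ∑ j : Fin n,
        dirDeriv (spaceDir (stdVec i)) (dirDeriv (spaceDir (stdVec j)) (height Y ν₀)) (0, t₀) *
          (2 * hess Y ν₀ t₀ w (stdVec i) * hess Y ν₀ t₀ w (stdVec j)) =
        2 * ∑ i, ∑ j, hess Y ν₀ t₀ (stdVec i) (stdVec j) *
            (hess Y ν₀ t₀ w (stdVec i) * hess Y ν₀ t₀ w (stdVec j)) := by
      simp only [Finset.mul_sum, hess]
      exact Finset.sum_congr rfl fun i _ => Finset.sum_congr rfl fun j _ => by ring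
    rw [e1]
    have e2 : ∑ i : Fin n, dirDeriv (spaceDir (stdVec i)) (dirDeriv (spaceDir (stdVec i))
        (height Y ν₀)) (0, t₀) = ∑ i, hess Y ν₀ t₀ (stdVec i) (stdVec i) := rfl
    rw [e2]
    ring

end IsGraphFlow

end MeanCurvatureJet

/-! ### Evolution equations for the metric, the second fundamental form and the mean curvature -/

section Touching

variable {n : ℕ} {V : Type*} [NormedAddCommGroup V] [InnerProductSpace ℝ V]

theorem dirDeriv_dirDeriv_inner_const {F : Type*} [NormedAddCommGroup F] [NormedSpace ℝ F]
    {f : F → V} {q : F} (hf : ContDiffAt ℝ ∞ f q) (c : V) (v w : F) :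
    dirDeriv v (dirDeriv w fun y => (inner ℝ (f y) c : ℝ)) q =
      inner ℝ (dirDeriv v (dirDeriv w f) q) c := by
  have h : dirDeriv w (fun y => (inner ℝ (f y) c : ℝ)) =ᶠ[𝓝 q]
      fun y => inner ℝ (dirDeriv w f y) c := by
    filter_upwards [eventually_differentiableAt hf] with y hy using dirDeriv_inner_const hy c w
  rw [(h.dirDeriv v).eq_of_nhds,
    dirDeriv_inner_const ((hf.dirDeriv w).differentiableAt (by simp))]

namespace IsGraphFlow

variable {Y N : Eucl n × ℝ → V} {t₀ : ℝ} {J : Eucl n →ₗᵢ[ℝ] V} {ν₀ p : V}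

/-- The second derivative of the mean curvature at the centre in the direction `w`. -/
noncomputable def meanSecond (Y : Eucl n × ℝ → V) (ν₀ : V) (t₀ : ℝ) (w : Eucl n) : ℝ :=
  ∑ i, dirDeriv (spaceDir w) (dirDeriv (spaceDir w) (dirDeriv (spaceDir (stdVec i))
      (dirDeriv (spaceDir (stdVec i)) (height Y ν₀)))) (0, t₀)
    - 2 * ∑ i, ∑ j, hess Y ν₀ t₀ (stdVec i) (stdVec j) *
        (hess Y ν₀ t₀ w (stdVec i) * hess Y ν₀ t₀ w (stdVec j))
    - (∑ i, hess Y ν₀ t₀ (stdVec i) (stdVec i)) * ∑ i, hess Y ν₀ t₀ w (stdVec i) ^ 2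

theorem tendsto_time (n : ℕ) (t₀ : ℝ) :
    Tendsto (fun s : ℝ => ((0 : Eucl n), t₀) + s • timeDir n) (𝓝 0) (𝓝 ((0 : Eucl n), t₀)) := by
  have : Continuous fun s : ℝ => ((0 : Eucl n), t₀) + s • timeDir n := by fun_prop
  simpa using this.tendsto 0

theorem hess_eq_inner (h : IsGraphFlow Y N t₀ J ν₀ p) (v w : Eucl n) :
    hess Y ν₀ t₀ v w = inner ℝ (sliceDeriv N (0, t₀) v) (J w) := by
  rw [sliceDeriv_apply, ← h.dirDeriv_zero, h.inner_dirDeriv_normal.self_of_nhds,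
    h.dirDeriv_dirDeriv_eq.self_of_nhds, h.normal_zero, inner_neg_right, real_inner_smul_right,
    real_inner_self_eq_norm_sq, h.norm_normal_zero]
  simp [hess]

theorem hess_comm (h : IsGraphFlow Y N t₀ J ν₀ p) (v w : Eucl n) :
    hess Y ν₀ t₀ v w = hess Y ν₀ t₀ w v :=
  (dirDeriv_comm h.height_contDiffAt (spaceDir v) (spaceDir w)).eq_of_nhds

theorem sliceDeriv_zero (h : IsGraphFlow Y N t₀ J ν₀ p) :
    sliceDeriv Y (0, t₀) = J.toContinuousLinearMap := by
  ext w : 1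
  exact h.dirDeriv_zero w

theorem sliceMean_zero (h : IsGraphFlow Y N t₀ J ν₀ p) :
    sliceMean Y N (0, t₀) = ∑ i, hess Y ν₀ t₀ (stdVec i) (stdVec i) := by
  obtain ⟨b, hb⟩ := h.hasJet_sliceMean 0
  simpa using hb.value

theorem dirDeriv_time_normal (h : IsGraphFlow Y N t₀ J ν₀ p) :
    inner ℝ (dirDeriv (timeDir n) N (0, t₀)) ν₀ = 0 := by
  have hd := h.normal_smooth.differentiableAt (by simp)
  have h1 := dirDeriv_inner hd hd (timeDir n)
  have h2 : (fun q => (inner ℝ (N q) (N q) : ℝ)) =ᶠ[𝓝 (0, t₀)] fun _ => 1 := by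
    filter_upwards [h.norm_normal] with q hq
    rw [real_inner_self_eq_norm_sq, hq]; norm_num
  have h3 : dirDeriv (timeDir n) (fun _ : Eucl n × ℝ => (1 : ℝ)) (0, t₀) = 0 := by simp [dirDeriv]
  rw [(h2.dirDeriv _).eq_of_nhds, h3, real_inner_comm, h.normal_zero] at h1
  linarith

/-- The normal speed along a line in the central slice. -/
theorem second_dirDeriv_speed (h : IsGraphFlow Y N t₀ J ν₀ p) (v : Eucl n) :
    inner ℝ (dirDeriv (spaceDir v) (dirDeriv (spaceDir v) (dirDeriv (timeDir n) Y)) (0, t₀)) ν₀ =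
      -(meanSecond Y ν₀ t₀ v -
        (∑ i, hess Y ν₀ t₀ (stdVec i) (stdVec i)) * ∑ i, hess Y ν₀ t₀ v (stdVec i) ^ 2) := by
  rw [← dirDeriv_dirDeriv_inner_const (h.smooth.dirDeriv _)]
  obtain ⟨b, hb⟩ := h.hasJet_sliceMean v
  have h1 := (hb.mul (h.hasJet_normal v)).const_mul (-1)
  have h2 := HasJet.of_contDiffAt ((h.smooth.dirDeriv (timeDir n)).inner ℝ
    (contDiffAt_const (c := ν₀))) (spaceDir v)
  -- By the flow equation `⟨∂_t Y, ν₀⟩ = -H⟨N, ν₀⟩` along the line; the second coefficients of both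
  -- sides must agree.
  have h3 := (h2.congr (g := fun s => -1 * (sliceMean Y N ((0, t₀) + s • spaceDir v) *
      inner ℝ (N ((0, t₀) + s • spaceDir v)) ν₀)) ?_).unique h1
  · rw [h3.2, meanSecond]; ring
  · filter_upwards [(tendsto_line v).eventually ((tendsto_slice t₀).eventually h.evolves)] with s hs
    simp only [slice_add, zero_add, hs, real_inner_smul_left]
    ring

/-- The tangential part of the velocity is `-H⟨N, ν₀⟩u_w`. As `u_w` vanishes at the centre, only its
derivative survives. -/
theorem dirDeriv_speed_tangent (h : IsGraphFlow Y N t₀ J ν₀ p) (v w : Eucl n) :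
    inner ℝ (dirDeriv (spaceDir v) (dirDeriv (timeDir n) Y) (0, t₀)) (J w) =
      -((∑ i, hess Y ν₀ t₀ (stdVec i) (stdVec i)) * hess Y ν₀ t₀ v w) := by
  have hs := h.smooth.dirDeriv (timeDir n)
  rw [← dirDeriv_inner_const (hs.differentiableAt (by simp))]
  obtain ⟨b, hb⟩ := h.hasJet_sliceMean v
  have hu := (HasJet.of_contDiffAt (h.height_contDiffAt.dirDeriv (spaceDir w))
      (spaceDir v)).cast (h.dirDeriv_height_zero _) rfl rfl
  have h1 := (hb.mul ((h.hasJet_normal v).mul hu)).const_mul (-1)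
  have h2 := HasJet.of_contDiffAt (hs.inner ℝ (contDiffAt_const (c := J w))) (spaceDir v)
  have h3 := (h2.congr (g := fun s => -1 * (sliceMean Y N ((0, t₀) + s • spaceDir v) *
      (inner ℝ (N ((0, t₀) + s • spaceDir v)) ν₀ *
        dirDeriv (spaceDir w) (height Y ν₀) ((0, t₀) + s • spaceDir v)))) ?_).unique h1
  · rw [h3.1, hess]; ring
  · filter_upwards [(tendsto_line v).eventually ((tendsto_slice t₀).eventually h.evolves),
      (tendsto_line v).eventually h.inner_normal_isometry] with s hs hs'
    simp only [slice_add, zero_add, hs, real_inner_smul_left, hs']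
    ring

/-- The time derivative of the metric. -/
theorem hasDerivAt_metric (h : IsGraphFlow Y N t₀ J ν₀ p) (v w : Eucl n) :
    HasDerivAt (fun s : ℝ => (inner ℝ (sliceDeriv Y ((0, t₀) + s • timeDir n) v)
        (sliceDeriv Y ((0, t₀) + s • timeDir n) w) : ℝ))
      (-2 * (∑ i, hess Y ν₀ t₀ (stdVec i) (stdVec i)) * hess Y ν₀ t₀ v w) 0 := by
  have hd := fun x : Eucl n => (h.smooth.dirDeriv (spaceDir x)).differentiableAt (by simp)
  have h1 := hasDerivAt_line (q := (0, t₀)) (s := 0) (timeDir n)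
    (f := fun q => (inner ℝ (dirDeriv (spaceDir v) Y q) (dirDeriv (spaceDir w) Y q) : ℝ))
    (by simpa using (hd v).inner ℝ (hd w))
  refine h1.congr_deriv ?_
  rw [zero_smul, add_zero, dirDeriv_inner (hd v) (hd w),
    (dirDeriv_comm h.smooth (timeDir n) (spaceDir v)).eq_of_nhds,
    (dirDeriv_comm h.smooth (timeDir n) (spaceDir w)).eq_of_nhds, h.dirDeriv_zero,
    h.dirDeriv_zero, real_inner_comm, h.dirDeriv_speed_tangent, h.dirDeriv_speed_tangent,
    h.hess_comm w v]
  ring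

/-- The time derivative of the second fundamental form. -/
theorem hasDerivAt_second (h : IsGraphFlow Y N t₀ J ν₀ p) (v : Eucl n) :
    HasDerivAt (fun s : ℝ => (inner ℝ (sliceDeriv N ((0, t₀) + s • timeDir n) v)
        (sliceDeriv Y ((0, t₀) + s • timeDir n) v) : ℝ))
      (meanSecond Y ν₀ t₀ v -
        (∑ i, hess Y ν₀ t₀ (stdVec i) (stdVec i)) * ∑ i, hess Y ν₀ t₀ v (stdVec i) ^ 2) 0 := by
  have hN := h.normal_smooth.differentiableAt (by simp)
  have hY := ((h.smooth.dirDeriv (spaceDir v)).dirDeriv (spaceDir v)).differentiableAt (by simp)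
  have h1 := (hasDerivAt_line (q := (0, t₀)) (s := 0) (timeDir n)
    (f := fun q => (inner ℝ (N q) (dirDeriv (spaceDir v) (dirDeriv (spaceDir v) Y) q) : ℝ))
    (by simpa using hN.inner ℝ hY)).neg
  refine (h1.congr_deriv ?_).congr_of_eventuallyEq ?_
  -- With `A(v,v) = -⟨N, ∂_v∂_v Y⟩`, the term containing `∂_t N` drops out: `∂_v∂_v Y` is a multiple
  -- of `ν₀` at the centre and `∂_t N` is orthogonal to `ν₀`.
  · rw [zero_smul, add_zero, dirDeriv_inner hN hY, dirDeriv_comm_three h.smooth,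
      h.dirDeriv_dirDeriv_eq.self_of_nhds, inner_neg_right, real_inner_smul_right,
      h.dirDeriv_time_normal, h.normal_zero, real_inner_comm, h.second_dirDeriv_speed]
    ring
  · filter_upwards [(tendsto_time n t₀).eventually h.inner_dirDeriv_normal] with s hs
    exact hs v v

/-- The evolution of the mean curvature. -/
theorem hasDerivAt_sliceMean (h : IsGraphFlow Y N t₀ J ν₀ p) :
    HasDerivAt (fun s : ℝ => sliceMean Y N ((0, t₀) + s • timeDir n))
      (∑ i, meanSecond Y ν₀ t₀ (stdVec i) + (∑ i, hess Y ν₀ t₀ (stdVec i) (stdVec i)) *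
        ∑ i, ∑ j, hess Y ν₀ t₀ (stdVec i) (stdVec j) ^ 2) 0 := by
  have hcY : Tendsto (fun s : ℝ => sliceDeriv Y ((0, t₀) + s • timeDir n)) (𝓝 0)
      (𝓝 (sliceDeriv Y (0, t₀))) := by
    have h1 : ContinuousAt (fderiv ℝ Y) (0, t₀) :=
      (h.smooth.fderiv_right (m := ∞) (by simp)).continuousAt
    exact ((h1.clm_comp continuousAt_const :
      ContinuousAt (fun q => sliceDeriv Y q) (0, t₀))).tendsto.comp (tendsto_time n t₀)
  have hcN : Tendsto (fun s : ℝ => sliceDeriv N ((0, t₀) + s • timeDir n)) (𝓝 0)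
      (𝓝 (sliceDeriv N (0, t₀))) := by
    have h1 : ContinuousAt (fderiv ℝ N) (0, t₀) :=
      (h.normal_smooth.fderiv_right (m := ∞) (by simp)).continuousAt
    exact ((h1.clm_comp continuousAt_const :
      ContinuousAt (fun q => sliceDeriv N q) (0, t₀))).tendsto.comp (tendsto_time n t₀)
  have hinj : Function.Injective (sliceDeriv Y (0, t₀)) := by
    rw [h.sliceDeriv_zero]; exact J.injective
  have hW := tendsto_shapeMatrix hcY hcN hinj
  have hdet : ∀ᶠ s : ℝ in 𝓝 0, IsUnit (pairing (sliceDeriv Y ((0, t₀) + s • timeDir n))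
      (sliceDeriv Y ((0, t₀) + s • timeDir n))).det := by
    have h1 := ((continuous_id.matrix_det (R := ℝ) (n := Fin n)).tendsto _).comp
      (tendsto_pairing hcY hcY)
    have h2 := h1.eventually_ne (isUnit_det_pairing_self hinj).ne_zero
    filter_upwards [h2] with s hs using isUnit_iff_ne_zero.2 hs
  have hone : pairing (sliceDeriv Y (0, t₀)) (sliceDeriv Y (0, t₀)) = 1 := by
    rw [h.sliceDeriv_zero, pairing_isometry]
  -- From `G W = A` follows `tr W = tr A - tr((G - 1)W)`. Since `G = 1` at the centre,
  -- differentiating the last term requires only continuity of `W`, and no derivative of an inverse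
  -- matrix.
  have hform : ∀ᶠ s : ℝ in 𝓝 0, sliceMean Y N ((0, t₀) + s • timeDir n) =
      ∑ i, pairing (sliceDeriv N ((0, t₀) + s • timeDir n))
          (sliceDeriv Y ((0, t₀) + s • timeDir n)) i i -
        ∑ i, ∑ j, (pairing (sliceDeriv Y ((0, t₀) + s • timeDir n))
          (sliceDeriv Y ((0, t₀) + s • timeDir n)) i j - (1 : Matrix (Fin n) (Fin n) ℝ) i j) *
          shapeMatrix (sliceDeriv Y ((0, t₀) + s • timeDir n))
            (sliceDeriv N ((0, t₀) + s • timeDir n)) j i := by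
    filter_upwards [hdet] with s hs
    set G := pairing (sliceDeriv Y ((0, t₀) + s • timeDir n))
      (sliceDeriv Y ((0, t₀) + s • timeDir n))
    set A := pairing (sliceDeriv N ((0, t₀) + s • timeDir n))
      (sliceDeriv Y ((0, t₀) + s • timeDir n))
    set W := shapeMatrix (sliceDeriv Y ((0, t₀) + s • timeDir n))
      (sliceDeriv N ((0, t₀) + s • timeDir n)) with hWdef
    have h1 : W = A - (G - 1) * W := by
      rw [sub_mul, one_mul, hWdef, shapeMatrix, Matrix.mul_nonsing_inv_cancel_left _ _ hs,
        sub_sub_cancel]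
    have h2 : W.trace = A.trace - ((G - 1) * W).trace := by
      conv_lhs => rw [h1]
      rw [Matrix.trace_sub]
    exact h2
  have hterm : ∀ i j : Fin n, HasDerivAt (fun s : ℝ =>
      (pairing (sliceDeriv Y ((0, t₀) + s • timeDir n))
          (sliceDeriv Y ((0, t₀) + s • timeDir n)) i j - (1 : Matrix (Fin n) (Fin n) ℝ) i j) *
          shapeMatrix (sliceDeriv Y ((0, t₀) + s • timeDir n))
            (sliceDeriv N ((0, t₀) + s • timeDir n)) j i)
      (-2 * (∑ i, hess Y ν₀ t₀ (stdVec i) (stdVec i)) * hess Y ν₀ t₀ (stdVec i) (stdVec j) *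
        hess Y ν₀ t₀ (stdVec i) (stdVec j)) 0 := by
    intro i j
    have h1 := (h.hasDerivAt_metric (stdVec i) (stdVec j)).sub_const
      ((1 : Matrix (Fin n) (Fin n) ℝ) i j)
    have hc : ContinuousAt (fun s : ℝ => shapeMatrix (sliceDeriv Y ((0, t₀) + s • timeDir n))
            (sliceDeriv N ((0, t₀) + s • timeDir n)) j i) 0 := by
      have h2 := tendsto_pi_nhds.1 (tendsto_pi_nhds.1 hW j) i
      simpa [ContinuousAt] using h2
    refine (hasDerivAt_mul_of_eq_zero h1 ?_ hc).congr_deriv ?_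
    · have := congrFun (congrFun hone i) j
      simp only [zero_smul, add_zero]
      exact sub_eq_zero.2 this
    · simp only [zero_smul, add_zero]
      rw [shapeMatrix, hone, inv_one, one_mul, h.sliceDeriv_zero,
        h.hess_comm (stdVec i) (stdVec j)]
      congr 1
      exact (h.hess_eq_inner (stdVec j) (stdVec i)).symm
  have hfinal := (HasDerivAt.fun_sum fun i (_ : i ∈ Finset.univ) =>
      h.hasDerivAt_second (stdVec i)).sub
    (HasDerivAt.fun_sum fun i (_ : i ∈ Finset.univ) =>
      HasDerivAt.fun_sum fun j (_ : j ∈ Finset.univ) => hterm i j)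
  refine (hfinal.congr_of_eventuallyEq hform).congr_deriv ?_
  rw [Finset.sum_sub_distrib, ← Finset.mul_sum]
  have e : ∑ i : Fin n, ∑ j : Fin n, -2 * (∑ i, hess Y ν₀ t₀ (stdVec i) (stdVec i)) *
      hess Y ν₀ t₀ (stdVec i) (stdVec j) * hess Y ν₀ t₀ (stdVec i) (stdVec j) =
      -2 * ((∑ i, hess Y ν₀ t₀ (stdVec i) (stdVec i)) *
        ∑ i, ∑ j, hess Y ν₀ t₀ (stdVec i) (stdVec j) ^ 2) := by
    generalize ∑ i, hess Y ν₀ t₀ (stdVec i) (stdVec i) = H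
    simp only [Finset.mul_sum]
    exact Finset.sum_congr rfl fun i _ => Finset.sum_congr rfl fun j _ => by ring
  rw [e]
  ring

end IsGraphFlow

end Touching

/-! ### The barrier and the maximum principle at a touching point -/

section Barrier

variable {n : ℕ} {V : Type*} [NormedAddCommGroup V] [InnerProductSpace ℝ V]

/-- The barrier at infinity: `|X|² + 2nt` solves the heat equation along the flow. -/
noncomputable def barrier (n : ℕ) (K ε m t : ℝ) (x : V) : ℝ :=
  Real.exp (K * t) * (ε * (‖x‖ ^ 2 + 2 * n * t) + m)

namespace IsGraphFlow

variable {Y N : Eucl n × ℝ → V} {t₀ : ℝ} {J : Eucl n →ₗᵢ[ℝ] V} {ν₀ p : V}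

theorem hasJet_barrier (h : IsGraphFlow Y N t₀ J ν₀ p) (K ε m : ℝ) (i : Fin n) :
    ∃ b, HasJet (fun s => barrier n K ε m t₀ (Y ((0, t₀) + s • spaceDir (stdVec i))))
      (barrier n K ε m t₀ (Y (0, t₀))) b
      (Real.exp (K * t₀) * ε * (2 - 2 * hess Y ν₀ t₀ (stdVec i) (stdVec i) *
        inner ℝ (Y (0, t₀)) ν₀)) := by
  have h1 := HasJet.of_contDiffAt (h.smooth.inner ℝ h.smooth) (spaceDir (stdVec i))
  have h2 : dirDeriv (spaceDir (stdVec i)) (fun q => (inner ℝ (Y q) (Y q) : ℝ)) =ᶠ[𝓝 (0, t₀)]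
      fun q => 2 * inner ℝ (dirDeriv (spaceDir (stdVec i)) Y q) (Y q) := by
    filter_upwards [eventually_differentiableAt h.smooth] with q hq
    rw [dirDeriv_inner hq hq, real_inner_comm]; ring
  have hd := h.smooth.differentiableAt (by simp)
  have hdd := (h.smooth.dirDeriv (spaceDir (stdVec i))).differentiableAt (by simp)
  have h3 : dirDeriv (spaceDir (stdVec i)) (dirDeriv (spaceDir (stdVec i))
      (fun q => (inner ℝ (Y q) (Y q) : ℝ))) (0, t₀) =
      2 - 2 * hess Y ν₀ t₀ (stdVec i) (stdVec i) * inner ℝ (Y (0, t₀)) ν₀ := by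
    have h4 : dirDeriv (spaceDir (stdVec i))
        (fun q => 2 * (inner ℝ (dirDeriv (spaceDir (stdVec i)) Y q) (Y q) : ℝ)) (0, t₀) =
        2 * dirDeriv (spaceDir (stdVec i))
          (fun q => (inner ℝ (dirDeriv (spaceDir (stdVec i)) Y q) (Y q) : ℝ)) (0, t₀) := by
      have h5 := ((hdd.inner ℝ hd).hasFDerivAt.const_mul (2 : ℝ)).fderiv
      exact congrArg (fun T => T (spaceDir (stdVec i))) h5
    rw [(h2.dirDeriv _).eq_of_nhds, h4, dirDeriv_inner hdd hd,
      h.dirDeriv_dirDeriv_eq.self_of_nhds, h.dirDeriv_zero, inner_neg_left, real_inner_smul_left,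
      real_inner_self_eq_norm_sq, J.norm_map, real_inner_comm ν₀]
    simp [hess, stdVec]
    ring
  have h5 := ((((h1.add (HasJet.const (2 * n * t₀))).const_mul ε).add
    (HasJet.const m)).const_mul (Real.exp (K * t₀)))
  refine ⟨_, (h5.congr (.of_forall fun s => ?_)).cast ?_ rfl ?_⟩
  · simp only [barrier, real_inner_self_eq_norm_sq]
  · simp only [barrier, real_inner_self_eq_norm_sq]
  · rw [h3]; ring

/-- By the flow equation `∂_t|X|² = -2H⟨X, ν⟩`, while the second derivatives in `hasJet_barrier` sum
to the multiple `e^{Kt}ε` of `2n - 2H⟨X, ν⟩`. Hence time derivative minus Laplacian of the barrier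
is exactly `K` times the barrier. -/
theorem hasDerivAt_barrier (h : IsGraphFlow Y N t₀ J ν₀ p) (K ε m : ℝ) :
    HasDerivAt (fun s : ℝ => barrier n K ε m (t₀ + s) (Y ((0, t₀) + s • timeDir n)))
      (K * barrier n K ε m t₀ (Y (0, t₀)) + Real.exp (K * t₀) * ε *
        (2 * n - 2 * (∑ i, hess Y ν₀ t₀ (stdVec i) (stdVec i)) * inner ℝ (Y (0, t₀)) ν₀)) 0 := by
  have hd := h.smooth.differentiableAt (by simp)
  have h1 := hasDerivAt_line (q := (0, t₀)) (s := 0) (timeDir n)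
    (f := fun q => (inner ℝ (Y q) (Y q) : ℝ)) (by simpa using hd.inner ℝ hd)
  have h2 : dirDeriv (timeDir n) (fun q => (inner ℝ (Y q) (Y q) : ℝ)) (0, t₀) =
      -2 * (∑ i, hess Y ν₀ t₀ (stdVec i) (stdVec i)) * inner ℝ (Y (0, t₀)) ν₀ := by
    rw [dirDeriv_inner hd hd, h.evolves.self_of_nhds, h.normal_zero, h.sliceMean_zero,
      real_inner_smul_left, real_inner_smul_right, real_inner_comm ν₀]
    ring
  rw [zero_smul, add_zero, h2] at h1
  have hid : HasDerivAt (fun s : ℝ => t₀ + s) 1 0 := (hasDerivAt_id 0).const_add t₀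
  have h3 := ((hid.const_mul K).exp).mul (((h1.add (hid.const_mul (2 * n : ℝ))).const_mul ε).add_const m)
  refine (h3.congr_of_eventuallyEq (.of_forall fun s => ?_)).congr_deriv ?_
  · simp only [barrier, real_inner_self_eq_norm_sq, Pi.add_apply, Pi.mul_apply]
  · simp only [barrier, real_inner_self_eq_norm_sq, Pi.add_apply, zero_smul, add_zero]
    ring

/-- The tensor maximum principle at an interior point: a solution cannot touch the barrier. -/
theorem not_touching (h : IsGraphFlow Y N t₀ J ν₀ p) {α K ε m : ℝ} {v : Eucl n} (hv : ‖v‖ = 1)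
    (hge : ∀ᶠ q in 𝓝 ((0 : Eucl n), t₀), q.2 ≤ t₀ → ∀ w,
      (α * sliceMean Y N q - barrier n K ε m q.2 (Y q)) * ‖sliceDeriv Y q w‖ ^ 2 ≤
        inner ℝ (sliceDeriv N q w) (sliceDeriv Y q w))
    (heq : inner ℝ (sliceDeriv N (0, t₀) v) (sliceDeriv Y (0, t₀) v) =
      (α * sliceMean Y N (0, t₀) - barrier n K ε m t₀ (Y (0, t₀))) *
        ‖sliceDeriv Y (0, t₀) v‖ ^ 2)
    (hη : 0 < barrier n K ε m t₀ (Y (0, t₀)))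
    (hK : (shapeMatrix (sliceDeriv Y (0, t₀)) (sliceDeriv N (0, t₀)) *
      shapeMatrix (sliceDeriv Y (0, t₀)) (sliceDeriv N (0, t₀))).trace < K) : False := by
  set μ := α * sliceMean Y N (0, t₀) - barrier n K ε m t₀ (Y (0, t₀)) with hμ
  have hsym : ∀ x y, inner ℝ (sliceDeriv N (0, t₀) x) (J y) =
      inner ℝ (sliceDeriv N (0, t₀) y) (J x) := fun x y => by
    rw [← h.hess_eq_inner, ← h.hess_eq_inner, h.hess_comm]
  have hJ : ∀ x, sliceDeriv Y (0, t₀) x = J x := fun x => h.dirDeriv_zero x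
  rw [h.sliceDeriv_zero, trace_sq_shapeMatrix_isometry hsym] at hK
  simp only [← h.hess_eq_inner] at hK
  -- Equality in the Rayleigh bound at the centre makes `v` an eigenvector with eigenvalue `μ`, so
  -- every contraction of the Hessian with `v` becomes a power of `μ`.
  have heig : ∀ x, hess Y ν₀ t₀ x v = μ * inner ℝ x v := by
    intro x
    have h1 := inner_eq_of_rayleigh_le (L := J.toContinuousLinearMap) (N := sliceDeriv N (0, t₀))
      (μ := μ) (w := v) hsym (fun w => by
        have := hge.self_of_nhds le_rfl w
        rwa [hJ] at this) (by rw [← h.sliceDeriv_zero]; exact heq) x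
    rw [h.hess_eq_inner]
    simpa using h1
  have heig' : ∀ i, hess Y ν₀ t₀ v (stdVec i) = μ * v i := fun i => by
    rw [h.hess_comm, heig]; simp [stdVec, EuclideanSpace.inner_single_left]
  have hvsum : ∑ i, v i ^ 2 = 1 := by
    rw [← EuclideanSpace.real_norm_sq_eq, hv]; norm_num
  have hP : ∑ i, hess Y ν₀ t₀ v (stdVec i) ^ 2 = μ ^ 2 := by
    simp only [heig', mul_pow]
    rw [← Finset.mul_sum, hvsum, mul_one]
  have hP' : ∑ i, hess Y ν₀ t₀ (stdVec i) v ^ 2 = μ ^ 2 := by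
    rw [← hP]; exact Finset.sum_congr rfl fun i _ => by rw [h.hess_comm]
  have hcube : ∑ i, ∑ j, hess Y ν₀ t₀ (stdVec i) (stdVec j) *
        (hess Y ν₀ t₀ v (stdVec i) * hess Y ν₀ t₀ v (stdVec j)) = μ ^ 3 := by
    have h1 : ∀ i : Fin n, ∑ j, hess Y ν₀ t₀ (stdVec i) (stdVec j) * v j = μ * v i := by
      intro i
      rw [← heig' i, h.hess_comm, h.hess_eq_inner]
      conv_rhs => rw [eucl_eq_sum v]
      simp only [map_sum, map_smul, inner_sum, real_inner_smul_right, ← h.hess_eq_inner]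
      exact Finset.sum_congr rfl fun j _ => mul_comm _ _
    have h2 : ∀ i : Fin n, ∑ j, hess Y ν₀ t₀ (stdVec i) (stdVec j) *
        (hess Y ν₀ t₀ v (stdVec i) * hess Y ν₀ t₀ v (stdVec j)) = μ ^ 3 * v i ^ 2 := by
      intro i
      have : ∀ j : Fin n, hess Y ν₀ t₀ (stdVec i) (stdVec j) *
          (hess Y ν₀ t₀ v (stdVec i) * hess Y ν₀ t₀ v (stdVec j)) =
          μ ^ 2 * v i * (hess Y ν₀ t₀ (stdVec i) (stdVec j) * v j) := fun j => by
        rw [heig', heig']; ring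
      simp only [this]
      rw [← Finset.mul_sum, h1]; ring
    simp only [h2]
    rw [← Finset.mul_sum, hvsum, mul_one]
  set H := ∑ i, hess Y ν₀ t₀ (stdVec i) (stdVec i) with hH
  set S := ∑ i, ∑ j, hess Y ν₀ t₀ (stdVec i) (stdVec j) ^ 2 with hS
  set y₀ : ℝ := inner ℝ (Y (0, t₀)) ν₀
  set η := barrier n K ε m t₀ (Y (0, t₀)) with hηdef
  have hvv : hess Y ν₀ t₀ v v = μ := by
    rw [heig, real_inner_self_eq_norm_sq, hv]; ring
  have hJv : ‖sliceDeriv Y (0, t₀) v‖ ^ 2 = 1 := by rw [hJ, J.norm_map, hv]; norm_num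
  -- the time derivative
  have htime : meanSecond Y ν₀ t₀ v - H * μ ^ 2 -
      ((α * (∑ i, meanSecond Y ν₀ t₀ (stdVec i) + H * S) -
        (K * η + Real.exp (K * t₀) * ε * (2 * n - 2 * H * y₀))) + μ * (-2 * H * μ)) ≤ 0 := by
    have h1 := h.hasDerivAt_second v
    have h2 := h.hasDerivAt_metric v v
    have h3 := (h.hasDerivAt_sliceMean.const_mul α).sub (h.hasDerivAt_barrier K ε m)
    have h4 := h1.sub (h3.mul h2)
    refine hasDerivAt_nonpos_of_eventually (h4.congr_deriv ?_) ?_ ?_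
    · simp only [Pi.sub_apply, zero_smul, add_zero, real_inner_self_eq_norm_sq, hJv, hP, hvv]
      rw [← hH, ← hS, ← hμ]
      ring
    · simp only [Pi.sub_apply, Pi.mul_apply, zero_smul, add_zero, real_inner_self_eq_norm_sq]
      rw [heq, ← hμ, sub_self]
    · filter_upwards [(tendsto_time n t₀).eventually hge] with s hs hs0
      have := hs (by simpa using hs0) v
      simp only [Pi.sub_apply, Pi.mul_apply, real_inner_self_eq_norm_sq]
      have e : (((0 : Eucl n), t₀) + s • timeDir n).2 = t₀ + s := by simp
      rw [e] at this
      linarith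
  -- the second derivatives in space
  have hspace : ∀ i : Fin n, 0 ≤ dirDeriv (spaceDir v) (dirDeriv (spaceDir v)
        (dirDeriv (spaceDir (stdVec i)) (dirDeriv (spaceDir (stdVec i)) (height Y ν₀)))) (0, t₀) -
      μ * ∑ j, hess Y ν₀ t₀ (stdVec i) (stdVec j) ^ 2 -
      (α * meanSecond Y ν₀ t₀ (stdVec i) - Real.exp (K * t₀) * ε *
        (2 - 2 * hess Y ν₀ t₀ (stdVec i) (stdVec i) * y₀)) -
      2 * μ * hess Y ν₀ t₀ (stdVec i) v ^ 2 := by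
    intro i
    obtain ⟨b, hb⟩ := h.hasJet_sliceMean (stdVec i)
    obtain ⟨d, hd⟩ := h.hasJet_barrier K ε m i
    have hθ := h.hasJet_normal (stdVec i)
    have hu := (HasJet.of_contDiffAt (h.height_contDiffAt.dirDeriv (spaceDir v))
      (spaceDir (stdVec i))).cast (h.dirDeriv_height_zero _) rfl rfl
    have huu := HasJet.of_contDiffAt ((h.height_contDiffAt.dirDeriv (spaceDir v)).dirDeriv
      (spaceDir v)) (spaceDir (stdVec i))
    have h1 := (hθ.mul huu).sub (((hb.const_mul α).sub hd).mul
      ((HasJet.const 1).add (hu.mul hu)))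
    -- After the exchange, the fourth-order terms match those in `meanSecond` along `v`, which
    -- enters the time derivative.
    rw [dirDeriv_comm_four h.height_contDiffAt] at h1
    have hvv' : dirDeriv (spaceDir v) (dirDeriv (spaceDir v) (height Y ν₀)) (0, t₀) = μ := hvv
    have hμ' : α * H - η = μ := by rw [hμ, h.sliceMean_zero]
    refine HasJet.second_nonneg ((h1.congr (g := fun s =>
      inner ℝ (sliceDeriv N ((0, t₀) + s • spaceDir (stdVec i)) v)
        (sliceDeriv Y ((0, t₀) + s • spaceDir (stdVec i)) v) -
      (α * sliceMean Y N ((0, t₀) + s • spaceDir (stdVec i)) -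
        barrier n K ε m t₀ (Y ((0, t₀) + s • spaceDir (stdVec i)))) *
        ‖sliceDeriv Y ((0, t₀) + s • spaceDir (stdVec i)) v‖ ^ 2) ?_).cast ?_ rfl ?_) ?_
    · filter_upwards [(tendsto_line (stdVec i)).eventually h.dirDeriv_eq,
        (tendsto_line (stdVec i)).eventually h.dirDeriv_dirDeriv_eq,
        (tendsto_line (stdVec i)).eventually ((tendsto_slice t₀).eventually
          h.inner_dirDeriv_normal)] with s k1 k2 k3
      simp only [slice_add, zero_add]
      rw [← real_inner_self_eq_norm_sq]
      simp only [sliceDeriv_apply]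
      rw [k3, k2, k1]
      simp only [inner_neg_right, inner_sub_left, inner_sub_right, real_inner_smul_left,
        real_inner_smul_right, real_inner_self_eq_norm_sq, h.norm_normal_zero, J.norm_map, hv,
        norm_smul, mul_one, Real.norm_eq_abs, sq_abs,
        h.inner_isometry_normal, real_inner_comm (J v) ν₀]
      ring
    · rw [hvv']
      linarith
    · have hiv : dirDeriv (spaceDir (stdVec i)) (dirDeriv (spaceDir v) (height Y ν₀)) (0, t₀) =
        hess Y ν₀ t₀ (stdVec i) v := rfl
      have hy : (inner ℝ (Y (0, t₀)) ν₀ : ℝ) = y₀ := rfl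
      rw [hvv', ← hH, ← hηdef, hμ', hiv, hy, meanSecond, ← hH]
      ring
    · filter_upwards [(tendsto_line (stdVec i)).eventually ((tendsto_slice t₀).eventually hge)]
        with s hs
      have := hs le_rfl v
      simp only [slice_add, zero_add]
      linarith
  -- The sum over an orthonormal basis is the Laplacian at the centre.
  have hsum := Finset.sum_nonneg fun i (_ : i ∈ Finset.univ) => hspace i
  simp only [Finset.sum_sub_distrib, ← Finset.mul_sum] at hsum
  rw [← hS, hP'] at hsum
  have hms : meanSecond Y ν₀ t₀ v = ∑ i, dirDeriv (spaceDir v) (dirDeriv (spaceDir v)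
      (dirDeriv (spaceDir (stdVec i)) (dirDeriv (spaceDir (stdVec i)) (height Y ν₀)))) (0, t₀) -
      2 * μ ^ 3 - H * μ ^ 2 := by
    rw [meanSecond, hcube, hP, ← hH]
  have hlin : ∑ x : Fin n, 2 * hess Y ν₀ t₀ (stdVec x) (stdVec x) * y₀ = 2 * H * y₀ := by
    rw [← Finset.sum_mul, ← Finset.mul_sum]
  rw [hlin] at hsum
  simp only [Finset.sum_const, Finset.card_univ, Fintype.card_fin, nsmul_eq_mul] at hsum
  rw [hms] at htime
  have hμ2 : μ = α * H - η := by rw [hμ, h.sliceMean_zero]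
  -- Subtracting the space inequality from the time inequality cancels the fourth derivatives of the
  -- height, the second derivatives of `H`, the cubic terms and the `ε` terms. There remains `Kη +
  -- μS - αHS ≤ 0`, and `μ = αH - η`.
  have key : (K - S) * η ≤ 0 := by
    have e1 : μ * S = α * H * S - η * S := by rw [hμ2]; ring
    nlinarith
  have : 0 < (K - S) * η := mul_pos (by linarith) hη
  linarith

end IsGraphFlow

end Barrier

/-! ### Changes of frame -/

section Frames

variable {n : ℕ} {V : Type*} [NormedAddCommGroup V] [InnerProductSpace ℝ V]

theorem spectrum_shapeMatrix_comp {L N : Eucl n →L[ℝ] V} {B : Eucl n →L[ℝ] Eucl n}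
    (hB : Function.Injective B) :
    spectrum ℝ (shapeMatrix (L.comp B) (N.comp B)) = spectrum ℝ (shapeMatrix L N) := by
  have hb := isUnit_det_endMatrix hB
  rw [shapeMatrix_comp hB]
  let u : (Matrix (Fin n) (Fin n) ℝ)ˣ := ⟨endMatrix B, (endMatrix B)⁻¹,
    Matrix.mul_nonsing_inv _ hb, Matrix.nonsing_inv_mul _ hb⟩
  exact spectrum.units_conjugate' (u := u)

theorem surjective_of_injective {B : Eucl n →L[ℝ] Eucl n} (hB : Function.Injective B) :
    Function.Surjective B :=
  (LinearMap.injective_iff_surjective (f := (B : Eucl n →ₗ[ℝ] Eucl n))).1 hB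

end Frames

/-! ### Local parametrisations and symmetry of the second fundamental form -/

section Charts

variable {n : ℕ} {M : Type*} [TopologicalSpace M] [ChartedSpace (Eucl n) M]

/-- The differential of a local parametrisation of a manifold. -/
noncomputable def paramDeriv (Φ : Eucl n → M) (y : Eucl n) : Eucl n →L[ℝ] Eucl n :=
  mfderiv 𝓘(ℝ, Eucl n) (𝓡 n) Φ y

theorem meanCurvature_eq (f ν : M → Eucl (n + 1)) (x : M) :
    meanCurvature f ν x = (shapeMatrix (differential f x) (differential ν x)).trace := rfl

theorem kappaOne_eq (f ν : M → Eucl (n + 1)) (x : M) :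
    kappaOne f ν x = sInf (spectrum ℝ (shapeMatrix (differential f x) (differential ν x))) := rfl

theorem normA_eq (f ν : M → Eucl (n + 1)) (x : M) :
    normA f ν x = √(shapeMatrix (differential f x) (differential ν x) *
      shapeMatrix (differential f x) (differential ν x)).trace := rfl

theorem fderiv_comp_param {f : M → Eucl (n + 1)} {Φ : Eucl n → M} {y : Eucl n}
    (hf : MDifferentiableAt (𝓡 n) 𝓘(ℝ, Eucl (n + 1)) f (Φ y))
    (hΦ : MDifferentiableAt 𝓘(ℝ, Eucl n) (𝓡 n) Φ y) :
    fderiv ℝ (f ∘ Φ) y = (differential f (Φ y)).comp (paramDeriv Φ y) := by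
  rw [← mfderiv_eq_fderiv]
  exact mfderiv_comp y hf hΦ

variable [IsManifold (𝓡 n) ∞ M]

theorem mdifferentiableAt_chart_symm {x₀ : M} {z : Eucl n}
    (hz : z ∈ (extChartAt (𝓡 n) x₀).target) :
    MDifferentiableAt 𝓘(ℝ, Eucl n) (𝓡 n) (extChartAt (𝓡 n) x₀).symm z :=
  (((contMDiffOn_extChartAt_symm (n := ∞) x₀) z hz).contMDiffAt
    ((isOpen_extChartAt_target x₀).mem_nhds hz)).mdifferentiableAt (by simp)

theorem injective_paramDeriv_chart_symm {x₀ : M} {z : Eucl n}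
    (hz : z ∈ (extChartAt (𝓡 n) x₀).target) :
    Function.Injective (paramDeriv (extChartAt (𝓡 n) x₀).symm z) := by
  have : IsManifold (𝓡 n) 1 M := IsManifold.of_le (n := ∞) (by exact_mod_cast le_top)
  have h := isInvertible_mfderivWithin_extChartAt_symm (I := 𝓡 n) hz
  rw [ModelWithCorners.range_eq_univ, mfderivWithin_univ] at h
  exact h.injective

theorem contDiffOn_chart {X : ℝ → M → Eucl (n + 1)} {δ : ℝ}
    (hX : ContMDiffOn ((𝓡 n).prod 𝓘(ℝ, ℝ)) 𝓘(ℝ, Eucl (n + 1)) ∞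
      (fun p : M × ℝ => X p.2 p.1) (Set.univ ×ˢ Set.Icc 0 δ)) (x₀ : M) :
    ContDiffOn ℝ ∞ (fun q : Eucl n × ℝ => X q.2 ((extChartAt (𝓡 n) x₀).symm q.1))
      ((extChartAt (𝓡 n) x₀).target ×ˢ Set.Icc 0 δ) := by
  rw [← contMDiffOn_iff_contDiffOn, modelWithCornersSelf_prod, ← chartedSpaceSelf_prod]
  have h1 : ContMDiffOn (𝓘(ℝ, Eucl n).prod 𝓘(ℝ, ℝ)) ((𝓡 n).prod 𝓘(ℝ, ℝ)) ∞
      (fun q : Eucl n × ℝ => ((extChartAt (𝓡 n) x₀).symm q.1, q.2))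
      ((extChartAt (𝓡 n) x₀).target ×ˢ Set.Icc 0 δ) :=
    ((contMDiffOn_extChartAt_symm (n := ∞) x₀).comp contMDiffOn_fst
      (fun q hq => hq.1)).prodMk contMDiffOn_snd
  exact hX.comp h1 fun q hq => ⟨Set.mem_univ _, hq.2⟩

/-- The Weingarten map is self-adjoint. -/
theorem inner_differential_comm {f ν : M → Eucl (n + 1)}
    (hf : ContMDiff (𝓡 n) 𝓘(ℝ, Eucl (n + 1)) ∞ f) (hν : ContMDiff (𝓡 n) 𝓘(ℝ, Eucl (n + 1)) ∞ ν)
    (horth : ∀ x v, inner ℝ (differential f x v) (ν x) = 0) (x : M) (v w : Eucl n) :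
    (inner ℝ (differential ν x v) (differential f x w) : ℝ) =
      inner ℝ (differential ν x w) (differential f x v) := by
  set Φ := (extChartAt (𝓡 n) x).symm with hΦ
  set z₀ := extChartAt (𝓡 n) x x
  have hz₀ : z₀ ∈ (extChartAt (𝓡 n) x).target := mem_extChartAt_target x
  have hx : Φ z₀ = x := extChartAt_to_inv x
  have hnhds := (isOpen_extChartAt_target (I := 𝓡 n) x).mem_nhds hz₀
  have hΦs : ContMDiffAt 𝓘(ℝ, Eucl n) (𝓡 n) ∞ Φ z₀ :=
    ((contMDiffOn_extChartAt_symm (n := ∞) x) z₀ hz₀).contMDiffAt hnhds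
  have hF : ContDiffAt ℝ ∞ (f ∘ Φ) z₀ :=
    contMDiffAt_iff_contDiffAt.1 (hf.contMDiffAt.comp z₀ hΦs)
  have hG : ContDiffAt ℝ ∞ (ν ∘ Φ) z₀ :=
    contMDiffAt_iff_contDiffAt.1 (hν.contMDiffAt.comp z₀ hΦs)
  have hor : ∀ a : Eucl n, (fun z => (inner ℝ (dirDeriv a (f ∘ Φ) z) ((ν ∘ Φ) z) : ℝ)) =ᶠ[𝓝 z₀]
      fun _ => 0 := by
    intro a
    filter_upwards [hnhds] with z hz
    rw [dirDeriv, fderiv_comp_param (hf.mdifferentiableAt (by simp))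
      (mdifferentiableAt_chart_symm hz)]
    exact horth _ _
  have key : ∀ a b : Eucl n, (inner ℝ (dirDeriv b (ν ∘ Φ) z₀) (dirDeriv a (f ∘ Φ) z₀) : ℝ) =
      -inner ℝ (dirDeriv b (dirDeriv a (f ∘ Φ)) z₀) ((ν ∘ Φ) z₀) := by
    intro a b
    have h1 := dirDeriv_inner ((hF.dirDeriv a).differentiableAt (by simp))
      (hG.differentiableAt (by simp)) b
    have h2 : dirDeriv b (fun _ : Eucl n => (0 : ℝ)) z₀ = 0 := by simp [dirDeriv]
    rw [((hor a).dirDeriv b).eq_of_nhds, h2, real_inner_comm] at h1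
    linarith
  -- Every tangent vector is the image of a constant coordinate vector, and for those the symmetry
  -- is that of second partial derivatives.
  obtain ⟨a, rfl⟩ := surjective_of_injective (injective_paramDeriv_chart_symm hz₀) v
  obtain ⟨b, rfl⟩ := surjective_of_injective (injective_paramDeriv_chart_symm hz₀) w
  have h1 := key a b
  have h2 := key b a
  rw [(dirDeriv_comm hF a b).eq_of_nhds, ← h1] at h2
  have eF := fderiv_comp_param (f := f) (Φ := Φ) (y := z₀) (hf.mdifferentiableAt (by simp))
    (mdifferentiableAt_chart_symm hz₀)
  have eG := fderiv_comp_param (f := ν) (Φ := Φ) (y := z₀) (hν.mdifferentiableAt (by simp))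
    (mdifferentiableAt_chart_symm hz₀)
  simp only [dirDeriv, eF, eG, hx] at h2
  exact h2

end Charts

/-! ### Continuity of curvature in space-time, up to the end times -/

section SpaceTime

variable {n : ℕ} {M : Type*} [TopologicalSpace M] [ChartedSpace (Eucl n) M]
  [IsManifold (𝓡 n) ∞ M]

/-- The differential of the slices of a map on space-time in a chart around `x₀`. -/
noncomputable def chartFrame (δ : ℝ) (X : ℝ → M → Eucl (n + 1)) (x₀ : M) (q : M × ℝ) :
    Eucl n →L[ℝ] Eucl (n + 1) :=
  (fderivWithin ℝ (fun p : Eucl n × ℝ => X p.2 ((extChartAt (𝓡 n) x₀).symm p.1))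
    ((extChartAt (𝓡 n) x₀).target ×ˢ Set.Icc 0 δ) (extChartAt (𝓡 n) x₀ q.1, q.2)).comp
    (ContinuousLinearMap.inl ℝ (Eucl n) ℝ)

variable {X : ℝ → M → Eucl (n + 1)} {δ : ℝ}

theorem chartFrame_eq
    (hX : ContMDiffOn ((𝓡 n).prod 𝓘(ℝ, ℝ)) 𝓘(ℝ, Eucl (n + 1)) ∞
      (fun p : M × ℝ => X p.2 p.1) (Set.univ ×ˢ Set.Icc 0 δ))
    (hXt : ∀ t ∈ Set.Icc 0 δ, ContMDiff (𝓡 n) 𝓘(ℝ, Eucl (n + 1)) ∞ (X t)) {x₀ : M} {q : M × ℝ}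
    (hx : q.1 ∈ (extChartAt (𝓡 n) x₀).source) (ht : q.2 ∈ Set.Icc 0 δ) :
    chartFrame δ X x₀ q = (differential (X q.2) q.1).comp
      (paramDeriv (extChartAt (𝓡 n) x₀).symm (extChartAt (𝓡 n) x₀ q.1)) := by
  have hz := (extChartAt (𝓡 n) x₀).map_source hx
  have hinv := (extChartAt (𝓡 n) x₀).left_inv hx
  have h1 := fderiv_comp_param (f := X q.2) ((hXt q.2 ht).mdifferentiableAt (by simp))
    (mdifferentiableAt_chart_symm hz)
  rw [hinv] at h1
  rw [← h1]
  have h2 := ((contDiffOn_chart hX x₀).differentiableOn (by simp) (extChartAt (𝓡 n) x₀ q.1, q.2)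
    ⟨hz, ht⟩).hasFDerivWithinAt
  have h3 : HasFDerivWithinAt (fun z : Eucl n => (z, q.2)) (ContinuousLinearMap.inl ℝ (Eucl n) ℝ)
      (extChartAt (𝓡 n) x₀).target (extChartAt (𝓡 n) x₀ q.1) :=
    (hasFDerivAt_prodMk_left _ _).hasFDerivWithinAt
  have hmaps : Set.MapsTo (fun z : Eucl n => (z, q.2)) (extChartAt (𝓡 n) x₀).target
      ((extChartAt (𝓡 n) x₀).target ×ˢ Set.Icc 0 δ) := fun z hz => ⟨hz, ht⟩
  have h4 := (h2.comp (extChartAt (𝓡 n) x₀ q.1) h3 hmaps).hasFDerivAt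
    ((isOpen_extChartAt_target x₀).mem_nhds hz)
  exact h4.fderiv.symm

/-- `differential` refers to the preferred chart of each point separately, so it need not vary
continuously. In one fixed chart the derivative does, including at `t = 0` and `t = δ`, because the
closed time interval has unique derivatives. -/
theorem tendsto_chartFrame (hδ : 0 < δ)
    (hX : ContMDiffOn ((𝓡 n).prod 𝓘(ℝ, ℝ)) 𝓘(ℝ, Eucl (n + 1)) ∞
      (fun p : M × ℝ => X p.2 p.1) (Set.univ ×ˢ Set.Icc 0 δ)) (x₀ : M) {t₀ : ℝ}
    (ht₀ : t₀ ∈ Set.Icc 0 δ) :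
    Tendsto (chartFrame δ X x₀) (𝓝[Set.univ ×ˢ Set.Icc 0 δ] (x₀, t₀))
      (𝓝 (chartFrame δ X x₀ (x₀, t₀))) := by
  have hu : UniqueDiffOn ℝ ((extChartAt (𝓡 n) x₀).target ×ˢ Set.Icc 0 δ) :=
    (isOpen_extChartAt_target x₀).uniqueDiffOn.prod (uniqueDiffOn_Icc hδ)
  have hc := ((contDiffOn_chart hX x₀).continuousOn_fderivWithin hu (by simp))
    (extChartAt (𝓡 n) x₀ x₀, t₀) ⟨mem_extChartAt_target x₀, ht₀⟩
  have hm : Tendsto (fun q : M × ℝ => (extChartAt (𝓡 n) x₀ q.1, q.2))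
      (𝓝[Set.univ ×ˢ Set.Icc 0 δ] (x₀, t₀))
      (𝓝[(extChartAt (𝓡 n) x₀).target ×ˢ Set.Icc 0 δ] (extChartAt (𝓡 n) x₀ x₀, t₀)) := by
    refine tendsto_nhdsWithin_iff.2 ⟨?_, ?_⟩
    · refine Tendsto.mono_left ?_ nhdsWithin_le_nhds
      have h1 : Tendsto (fun q : M × ℝ => q.1) (𝓝 (x₀, t₀)) (𝓝 x₀) := continuousAt_fst
      have h2 : Tendsto (fun q : M × ℝ => q.2) (𝓝 (x₀, t₀)) (𝓝 t₀) := continuousAt_snd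
      exact ((continuousAt_extChartAt (I := 𝓡 n) x₀).tendsto.comp h1).prodMk_nhds h2
    · have h1 : ∀ᶠ q : M × ℝ in 𝓝 (x₀, t₀), q.1 ∈ (extChartAt (𝓡 n) x₀).source :=
        continuousAt_fst.eventually (extChartAt_source_mem_nhds (I := 𝓡 n) x₀)
      filter_upwards [nhdsWithin_le_nhds h1, self_mem_nhdsWithin] with q h1 h2
      exact ⟨(extChartAt (𝓡 n) x₀).map_source h1, h2.2⟩
  have := hc.tendsto.comp hm
  exact ((ContinuousLinearMap.compL ℝ (Eucl n) (Eucl n × ℝ) (Eucl (n + 1))).flip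
    (ContinuousLinearMap.inl ℝ (Eucl n) ℝ)).continuous.continuousAt.tendsto.comp this

end SpaceTime

namespace IsConvexMeanCurvatureFlow

variable {n : ℕ} {M : Type*} [TopologicalSpace M] [ChartedSpace (Eucl n) M]
  [IsManifold (𝓡 n) ∞ M] {X ν : ℝ → M → Eucl (n + 1)} {δ : ℝ} {Ω : ℝ → Set (Eucl (n + 1))}

/-- Curvatures computed in the fixed chart are the intrinsic ones, by invariance under change of
frame; semicontinuity can therefore be proved for `chartFrame` and transferred. -/
theorem frame_spec (h : IsConvexMeanCurvatureFlow δ Ω X ν) (x₀ : M) (t₀ : ℝ) :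
    ∀ᶠ q in 𝓝[Set.univ ×ˢ Set.Icc 0 δ] (x₀, t₀),
      Function.Injective (chartFrame δ X x₀ q) ∧
      (∀ v w, inner ℝ (chartFrame δ ν x₀ q v) (chartFrame δ X x₀ q w) =
        inner ℝ (chartFrame δ ν x₀ q w) (chartFrame δ X x₀ q v)) ∧
      (shapeMatrix (chartFrame δ X x₀ q) (chartFrame δ ν x₀ q)).trace =
        meanCurvature (X q.2) (ν q.2) q.1 ∧
      sInf (spectrum ℝ (shapeMatrix (chartFrame δ X x₀ q) (chartFrame δ ν x₀ q))) =
        kappaOne (X q.2) (ν q.2) q.1 := by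
  have h1 : ∀ᶠ q : M × ℝ in 𝓝 (x₀, t₀), q.1 ∈ (extChartAt (𝓡 n) x₀).source :=
    continuousAt_fst.eventually (extChartAt_source_mem_nhds (I := 𝓡 n) x₀)
  filter_upwards [nhdsWithin_le_nhds h1, self_mem_nhdsWithin] with q hx hq
  have hB := injective_paramDeriv_chart_symm ((extChartAt (𝓡 n) x₀).map_source hx)
  have hs := h.hypersurface q.2 hq.2
  rw [chartFrame_eq h.smooth (fun t ht => (h.hypersurface t ht).contMDiff) hx hq.2,
    chartFrame_eq h.normal_smooth (fun t ht => (h.hypersurface t ht).normal_contMDiff) hx hq.2]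
  refine ⟨(hs.immersion q.1).comp hB, fun v w => ?_, ?_, ?_⟩
  · exact inner_differential_comm hs.contMDiff hs.normal_contMDiff hs.normal_orthogonal _ _ _
  · rw [trace_shapeMatrix_comp hB, meanCurvature_eq]
  · rw [spectrum_shapeMatrix_comp hB, kappaOne_eq]

theorem tendsto_meanCurvature (h : IsConvexMeanCurvatureFlow δ Ω X ν) (hδ : 0 < δ) {x₀ : M}
    {t₀ : ℝ} (ht₀ : t₀ ∈ Set.Icc 0 δ) :
    Tendsto (fun q : M × ℝ => meanCurvature (X q.2) (ν q.2) q.1)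
      (𝓝[Set.univ ×ˢ Set.Icc 0 δ] (x₀, t₀)) (𝓝 (meanCurvature (X t₀) (ν t₀) x₀)) := by
  have h0 := (h.frame_spec x₀ t₀).self_of_nhdsWithin ⟨Set.mem_univ _, ht₀⟩
  have h1 := tendsto_trace_shapeMatrix (tendsto_chartFrame hδ h.smooth x₀ ht₀)
    (tendsto_chartFrame hδ h.normal_smooth x₀ ht₀) h0.1
  rw [h0.2.2.1] at h1
  refine h1.congr' ?_
  filter_upwards [h.frame_spec x₀ t₀] with q hq using hq.2.2.1

theorem eventually_lt_kappaOne (h : IsConvexMeanCurvatureFlow δ Ω X ν) (hn : 1 ≤ n) (hδ : 0 < δ)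
    {x₀ : M} {t₀ : ℝ} (ht₀ : t₀ ∈ Set.Icc 0 δ) {c : M × ℝ → ℝ}
    (hc : Tendsto c (𝓝[Set.univ ×ˢ Set.Icc 0 δ] (x₀, t₀)) (𝓝 (c (x₀, t₀))))
    (hlt : c (x₀, t₀) < kappaOne (X t₀) (ν t₀) x₀) :
    ∀ᶠ q in 𝓝[Set.univ ×ˢ Set.Icc 0 δ] (x₀, t₀), c q < kappaOne (X q.2) (ν q.2) q.1 := by
  have hf := h.frame_spec x₀ t₀
  have h0 := hf.self_of_nhdsWithin ⟨Set.mem_univ _, ht₀⟩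
  have h1 := eventually_lt_sInf_spectrum hn (tendsto_chartFrame hδ h.smooth x₀ ht₀)
    (tendsto_chartFrame hδ h.normal_smooth x₀ ht₀) hc h0.1 h0.2.1
    (hf.mono fun q hq => hq.1) (hf.mono fun q hq => hq.2.1) (by rwa [h0.2.2.2])
  filter_upwards [h1, hf] with q h1 h2
  rwa [← h2.2.2.2]

theorem eventually_kappaOne_lt (h : IsConvexMeanCurvatureFlow δ Ω X ν) (hn : 1 ≤ n) (hδ : 0 < δ)
    {x₀ : M} {t₀ : ℝ} (ht₀ : t₀ ∈ Set.Icc 0 δ) {c : M × ℝ → ℝ}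
    (hc : Tendsto c (𝓝[Set.univ ×ˢ Set.Icc 0 δ] (x₀, t₀)) (𝓝 (c (x₀, t₀))))
    (hlt : kappaOne (X t₀) (ν t₀) x₀ < c (x₀, t₀)) :
    ∀ᶠ q in 𝓝[Set.univ ×ˢ Set.Icc 0 δ] (x₀, t₀), kappaOne (X q.2) (ν q.2) q.1 < c q := by
  have hf := h.frame_spec x₀ t₀
  have h0 := hf.self_of_nhdsWithin ⟨Set.mem_univ _, ht₀⟩
  have h1 := eventually_sInf_spectrum_lt hn (tendsto_chartFrame hδ h.smooth x₀ ht₀)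
    (tendsto_chartFrame hδ h.normal_smooth x₀ ht₀) hc h0.1 h0.2.1
    (hf.mono fun q hq => hq.1) (hf.mono fun q hq => hq.2.1) (by rwa [h0.2.2.2])
  filter_upwards [h1, hf] with q h1 h2
  rwa [← h2.2.2.2]

end IsConvexMeanCurvatureFlow

/-! ### Graph coordinates from the inverse function theorem -/

section GraphParametrisation

variable {n : ℕ}

/-- The range of `J` has codimension one, so `ν₀` spans its orthogonal complement. -/
theorem eq_tangent_add_normal {J : Eucl n →ₗᵢ[ℝ] Eucl (n + 1)} {ν₀ : Eucl (n + 1)}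
    (hν : ‖ν₀‖ = 1) (horth : ∀ w, inner ℝ (J w) ν₀ = 0) (z : Eucl (n + 1)) :
    z = J (∑ i, (inner ℝ z (J (stdVec i)) : ℝ) • stdVec i) + (inner ℝ z ν₀ : ℝ) • ν₀ := by
  let R := LinearMap.range J.toLinearMap
  have hfr : Module.finrank ℝ Rᗮ = 1 := by
    have h1 := R.finrank_add_finrank_orthogonal
    have h2 : Module.finrank ℝ R = n := by
      rw [LinearMap.finrank_range_of_inj J.injective]; simp
    rw [h2] at h1
    simp only [finrank_euclideanSpace, Fintype.card_fin] at h1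
    omega
  have hνR : ν₀ ∈ Rᗮ := by
    rw [Submodule.mem_orthogonal]
    rintro _ ⟨w, rfl⟩
    exact horth w
  set x := ∑ i, (inner ℝ z (J (stdVec i)) : ℝ) • stdVec i with hx
  have hxw : ∀ w, (inner ℝ z (J w) : ℝ) = inner ℝ x w := by
    intro w
    have h1 : (inner ℝ z (J w) : ℝ) = ∑ i, w i * inner ℝ z (J (stdVec i)) := by
      conv_lhs => rw [eucl_eq_sum w]
      simp [inner_sum, real_inner_smul_right, stdVec]
    rw [h1, hx, sum_inner]
    refine Finset.sum_congr rfl fun i _ => ?_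
    rw [real_inner_smul_left]
    simp [stdVec, EuclideanSpace.inner_single_left, mul_comm]
  have hzR : z - J x ∈ Rᗮ := by
    rw [Submodule.mem_orthogonal]
    rintro _ ⟨w, rfl⟩
    change inner ℝ (J w) (z - J x) = 0
    rw [real_inner_comm, inner_sub_left, J.inner_map_map, hxw, sub_self]
  have hne : (⟨ν₀, hνR⟩ : Rᗮ) ≠ 0 := by
    intro h0
    have : ν₀ = 0 := congrArg Subtype.val h0
    rw [this, norm_zero] at hν
    exact zero_ne_one hν
  obtain ⟨c, hc⟩ := (finrank_eq_one_iff_of_nonzero' _ hne).1 hfr ⟨z - J x, hzR⟩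
  have hc' : c • ν₀ = z - J x := congrArg Subtype.val hc
  have hcz : inner ℝ z ν₀ = c := by
    have h1 : z = J x + c • ν₀ := by rw [hc']; abel
    rw [h1, inner_add_left, horth, real_inner_smul_left, real_inner_self_eq_norm_sq, hν]; ring
  rw [hcz, hc']; abel

/-- A hypersurface can be parametrised as a graph over its tangent plane. -/
theorem exists_graph_coordinates {F : Eucl n → Eucl (n + 1)} {z₀ : Eucl n}
    (hF : ContDiffAt ℝ ∞ F z₀) (hinj : Function.Injective (fderiv ℝ F z₀)) :
    ∃ (J : Eucl n →ₗᵢ[ℝ] Eucl (n + 1)) (ψ : Eucl n → Eucl n),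
      (∀ w, ∃ v, J w = fderiv ℝ F z₀ v) ∧ ψ 0 = z₀ ∧ ContDiffAt ℝ ∞ ψ 0 ∧
      ∀ᶠ y in 𝓝 0, ∀ w, inner ℝ (F (ψ y)) (J w) = inner ℝ (F z₀) (J w) + inner ℝ y w := by
  obtain ⟨J, B, hB, hJ⟩ := exists_isometry_range_eq hinj
  have hJB : ∀ w, J w = fderiv ℝ F z₀ (B w) := fun w =>
    (congrArg (fun T : Eucl n →L[ℝ] Eucl (n + 1) => T w) hJ).symm
  let Jt : Eucl (n + 1) →L[ℝ] Eucl n := ContinuousLinearMap.adjoint J.toContinuousLinearMap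
  have hJt : ∀ z w, (inner ℝ (Jt z) w : ℝ) = inner ℝ z (J w) := fun z w =>
    ContinuousLinearMap.adjoint_inner_left J.toContinuousLinearMap w z
  have hTinj : Function.Injective (Jt.comp (fderiv ℝ F z₀)) := by
    -- The adjoint of `J` is orthogonal projection to the tangent plane; it inverts `J`, whose range
    -- is that of the differential. Projecting `F` is therefore a local diffeomorphism, with inverse
    -- `ψ`.
    rw [injective_iff_map_eq_zero]
    intro w hw
    obtain ⟨y, rfl⟩ := surjective_of_injective hB w
    have h1 : (inner ℝ (Jt (J y)) y : ℝ) = inner ℝ (J y) (J y) := hJt _ _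
    rw [ContinuousLinearMap.comp_apply, ← hJB] at hw
    rw [hw, inner_zero_left, J.inner_map_map, eq_comm, inner_self_eq_zero] at h1
    rw [h1, map_zero]
  let T : Eucl n ≃L[ℝ] Eucl n :=
    (LinearEquiv.ofInjectiveEndo ((Jt.comp (fderiv ℝ F z₀) : Eucl n →L[ℝ] Eucl n) :
      Eucl n →ₗ[ℝ] Eucl n) hTinj).toContinuousLinearEquiv
  have hP : ContDiffAt ℝ ∞ (fun z => Jt (F z)) z₀ := Jt.contDiff.contDiffAt.comp z₀ hF
  have hP' : HasFDerivAt (fun z => Jt (F z)) (T : Eucl n →L[ℝ] Eucl n) z₀ :=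
    Jt.hasFDerivAt.comp z₀ (hF.differentiableAt (by simp)).hasFDerivAt
  let ψ := hP.localInverse hP' (by simp)
  have hψ : ContDiffAt ℝ ∞ ψ (Jt (F z₀)) := hP.to_localInverse hP' (by simp)
  have hψ0 : ψ (Jt (F z₀)) = z₀ := hP.localInverse_apply_image hP' (by simp)
  have hright : ∀ᶠ y in 𝓝 (Jt (F z₀)), Jt (F (ψ y)) = y :=
    (hP.hasStrictFDerivAt' hP' (by simp)).eventually_right_inverse
  have ht : Tendsto (fun y : Eucl n => Jt (F z₀) + y) (𝓝 0) (𝓝 (Jt (F z₀))) := by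
    have : Continuous fun y : Eucl n => Jt (F z₀) + y := by fun_prop
    simpa using this.tendsto 0
  refine ⟨J, fun y => ψ (Jt (F z₀) + y), fun w => ⟨B w, hJB w⟩, by simpa using hψ0, ?_, ?_⟩
  · refine ContDiffAt.comp (g := ψ) (0 : Eucl n) ?_ (contDiffAt_const.add contDiffAt_id)
    simpa using hψ
  · filter_upwards [ht.eventually hright] with y hy w
    rw [← hJt, hy, inner_add_left, hJt]

end GraphParametrisation

/-! ### Graph coordinates for the flow at an interior time -/

namespace IsConvexMeanCurvatureFlow

variable {n : ℕ} {M : Type*} [TopologicalSpace M] [ChartedSpace (Eucl n) M]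
  [IsManifold (𝓡 n) ∞ M] {X ν : ℝ → M → Eucl (n + 1)} {δ : ℝ} {Ω : ℝ → Set (Eucl (n + 1))}

/-- The parametrisation `Φ` is chosen at time `t₀` and does not depend on time, so the flow equation
stays purely normal. Other slices need not be in graph form. -/
theorem exists_isGraphFlow (h : IsConvexMeanCurvatureFlow δ Ω X ν) (x₀ : M) {t₀ : ℝ}
    (ht₀ : t₀ ∈ Set.Ioo 0 δ) :
    ∃ (Φ : Eucl n → M) (J : Eucl n →ₗᵢ[ℝ] Eucl (n + 1)), Φ 0 = x₀ ∧
      IsGraphFlow (fun q : Eucl n × ℝ => X q.2 (Φ q.1)) (fun q : Eucl n × ℝ => ν q.2 (Φ q.1)) t₀ J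
        (ν t₀ x₀) (X t₀ x₀) ∧
      ∀ᶠ q : Eucl n × ℝ in 𝓝 (0, t₀), q.2 ∈ Set.Icc 0 δ ∧ ∃ B : Eucl n →L[ℝ] Eucl n,
        Function.Injective B ∧
        sliceDeriv (fun q : Eucl n × ℝ => X q.2 (Φ q.1)) q =
          (differential (X q.2) (Φ q.1)).comp B ∧
        sliceDeriv (fun q : Eucl n × ℝ => ν q.2 (Φ q.1)) q =
          (differential (ν q.2) (Φ q.1)).comp B := by
  set e := extChartAt (𝓡 n) x₀ with he
  set z₀ := e x₀ with hz₀def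
  have hz₀ : z₀ ∈ e.target := mem_extChartAt_target x₀
  have hez₀ : e.symm z₀ = x₀ := extChartAt_to_inv x₀
  have htarget : e.target ∈ 𝓝 z₀ := (isOpen_extChartAt_target (I := 𝓡 n) x₀).mem_nhds hz₀
  have hIcc : Set.Icc 0 δ ∈ 𝓝 t₀ := Icc_mem_nhds ht₀.1 ht₀.2
  have ht₀' : t₀ ∈ Set.Icc 0 δ := ⟨ht₀.1.le, ht₀.2.le⟩
  have hset : e.target ×ˢ Set.Icc 0 δ ∈ 𝓝 (z₀, t₀) := prod_mem_nhds htarget hIcc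
  have hf : ContDiffAt ℝ ∞ (fun q : Eucl n × ℝ => X q.2 (e.symm q.1)) (z₀, t₀) :=
    (contDiffOn_chart h.smooth x₀ _ ⟨hz₀, ht₀'⟩).contDiffAt hset
  have hg : ContDiffAt ℝ ∞ (fun q : Eucl n × ℝ => ν q.2 (e.symm q.1)) (z₀, t₀) :=
    (contDiffOn_chart h.normal_smooth x₀ _ ⟨hz₀, ht₀'⟩).contDiffAt hset
  have hs₀ := h.hypersurface t₀ ht₀'
  have hF : ContDiffAt ℝ ∞ (X t₀ ∘ e.symm) z₀ :=
    ContDiffAt.comp (g := fun q : Eucl n × ℝ => X q.2 (e.symm q.1)) (f := fun z => (z, t₀)) z₀ hf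
      (contDiffAt_id.prodMk contDiffAt_const)
  have hDF := fderiv_comp_param (f := X t₀) (Φ := e.symm) (y := z₀)
    (hs₀.contMDiff.mdifferentiableAt (by simp)) (mdifferentiableAt_chart_symm hz₀)
  have hFinj : Function.Injective (fderiv ℝ (X t₀ ∘ e.symm) z₀) := by
    rw [hDF]
    exact (hs₀.immersion _).comp (injective_paramDeriv_chart_symm hz₀)
  obtain ⟨J, ψ, hJ, hψ0, hψ, hgraph⟩ := exists_graph_coordinates hF hFinj
  set Φ : Eucl n → M := fun y => e.symm (ψ y) with hΦdef
  have hΦ0 : Φ 0 = x₀ := by rw [hΦdef]; simp only [hψ0, hez₀]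
  have hmap : ContDiffAt ℝ ∞ (fun q : Eucl n × ℝ => (ψ q.1, q.2)) (0, t₀) :=
    (ContDiffAt.comp (g := ψ) (f := Prod.fst) ((0 : Eucl n), t₀) hψ contDiffAt_fst).prodMk
      contDiffAt_snd
  have hY : ContDiffAt ℝ ∞ (fun q : Eucl n × ℝ => X q.2 (Φ q.1)) (0, t₀) :=
    ContDiffAt.comp (g := fun q : Eucl n × ℝ => X q.2 (e.symm q.1))
      (f := fun q : Eucl n × ℝ => (ψ q.1, q.2)) ((0 : Eucl n), t₀) (by simpa only [hψ0] using hf) hmap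
  have hN : ContDiffAt ℝ ∞ (fun q : Eucl n × ℝ => ν q.2 (Φ q.1)) (0, t₀) :=
    ContDiffAt.comp (g := fun q : Eucl n × ℝ => ν q.2 (e.symm q.1))
      (f := fun q : Eucl n × ℝ => (ψ q.1, q.2)) ((0 : Eucl n), t₀) (by simpa only [hψ0] using hg) hmap
  have hfst : Tendsto (fun q : Eucl n × ℝ => q.1) (𝓝 (0, t₀)) (𝓝 0) := continuousAt_fst
  have hsnd : Tendsto (fun q : Eucl n × ℝ => q.2) (𝓝 (0, t₀)) (𝓝 t₀) := continuousAt_snd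
  have hΦd : ∀ᶠ y in 𝓝 (0 : Eucl n), MDifferentiableAt 𝓘(ℝ, Eucl n) (𝓡 n) Φ y := by
    have h1 : ∀ᶠ y in 𝓝 (0 : Eucl n), ψ y ∈ e.target :=
      hψ.continuousAt.eventually (by rw [hψ0]; exact htarget)
    filter_upwards [h1, eventually_differentiableAt hψ] with y hy1 hy2
    exact (mdifferentiableAt_chart_symm hy1).comp y hy2.mdifferentiableAt
  have hslice : ∀ G : ℝ → M → Eucl (n + 1),
      (∀ t ∈ Set.Icc 0 δ, ContMDiff (𝓡 n) 𝓘(ℝ, Eucl (n + 1)) ∞ (G t)) →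
      ∀ q : Eucl n × ℝ, q.2 ∈ Set.Icc 0 δ →
      DifferentiableAt ℝ (fun q : Eucl n × ℝ => G q.2 (Φ q.1)) q →
      MDifferentiableAt 𝓘(ℝ, Eucl n) (𝓡 n) Φ q.1 →
      sliceDeriv (fun q : Eucl n × ℝ => G q.2 (Φ q.1)) q =
        (differential (G q.2) (Φ q.1)).comp (paramDeriv Φ q.1) := by
    intro G hG q hq hd hΦq
    rw [← fderiv_comp_param ((hG q.2 hq).mdifferentiableAt (by simp)) hΦq]
    exact (HasFDerivAt.comp q.1 (f := fun y : Eucl n => (y, q.2)) hd.hasFDerivAt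
      (hasFDerivAt_prodMk_left _ _)).fderiv.symm
  -- Differentiating the graph identity along `w` gives `⟨D(X ∘ Φ)w, J w⟩ = |w|²`, so `w` vanishes
  -- when its image under `paramDeriv Φ` does.
  have hBinj : ∀ᶠ y in 𝓝 (0 : Eucl n), Function.Injective (paramDeriv Φ y) := by
    filter_upwards [hgraph.eventually_nhds, hΦd] with y hy hy2
    rw [injective_iff_map_eq_zero]
    intro w hw
    have hXd : MDifferentiableAt (𝓡 n) 𝓘(ℝ, Eucl (n + 1)) (X t₀) (Φ y) :=
      hs₀.contMDiff.mdifferentiableAt (by simp)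
    have h1 := fderiv_comp_param hXd hy2
    have hd : DifferentiableAt ℝ (X t₀ ∘ Φ) y := (hXd.comp y hy2).differentiableAt
    have h2 : dirDeriv w (fun y => (inner ℝ ((X t₀ ∘ Φ) y) (J w) : ℝ)) y = 0 := by
      rw [dirDeriv_inner_const hd, dirDeriv, h1, ContinuousLinearMap.comp_apply, hw, map_zero,
        inner_zero_left]
    have h3 : (fun y => (inner ℝ ((X t₀ ∘ Φ) y) (J w) : ℝ)) =ᶠ[𝓝 y]
        fun y => inner ℝ ((X t₀ ∘ e.symm) z₀) (J w) + inner ℝ y w := by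
      filter_upwards [hy] with y hy using hy w
    rw [(h3.dirDeriv w).eq_of_nhds, dirDeriv, fderiv_const_add] at h2
    have h4 : (inner ℝ w w : ℝ) = 0 := by
      rw [← h2]
      have := dirDeriv_inner_const (f := fun y : Eucl n => y) (q := y) differentiableAt_id w w
      rw [dirDeriv] at this
      rw [this, dirDeriv]
      simp
    exact inner_self_eq_zero.1 h4
  have hframes : ∀ᶠ q : Eucl n × ℝ in 𝓝 (0, t₀), q.2 ∈ Set.Icc 0 δ ∧
      ∃ B : Eucl n →L[ℝ] Eucl n, Function.Injective B ∧
        sliceDeriv (fun q : Eucl n × ℝ => X q.2 (Φ q.1)) q =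
          (differential (X q.2) (Φ q.1)).comp B ∧
        sliceDeriv (fun q : Eucl n × ℝ => ν q.2 (Φ q.1)) q =
          (differential (ν q.2) (Φ q.1)).comp B := by
    filter_upwards [hsnd.eventually hIcc, hfst.eventually hΦd, hfst.eventually hBinj,
      eventually_differentiableAt hY, eventually_differentiableAt hN] with q h1 h2 h3 h4 h5
    exact ⟨h1, paramDeriv Φ q.1, h3,
      hslice X (fun t ht => (h.hypersurface t ht).contMDiff) q h1 h4 h2,
      hslice ν (fun t ht => (h.hypersurface t ht).normal_contMDiff) q h1 h5 h2⟩
  refine ⟨Φ, J, hΦ0, ?_, hframes⟩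
  refine
    { smooth := hY
      normal_smooth := hN
      normal_zero := by simp only [hΦ0]
      norm_normal := ?_
      orthogonal := ?_
      evolves := ?_
      graph := ?_
      decomp := ?_ }
  · filter_upwards [hsnd.eventually hIcc] with q hq using (h.hypersurface q.2 hq).norm_normal _
  · filter_upwards [hframes] with q ⟨hq, B, hB, h1, h2⟩ w
    rw [← sliceDeriv_apply, h1]
    exact (h.hypersurface q.2 hq).normal_orthogonal _ _
  -- At interior times the derivative within `[0, δ]` is a two-sided derivative.
  · have hIoo : ∀ᶠ t in 𝓝 t₀, t ∈ Set.Ioo 0 δ := Ioo_mem_nhds ht₀.1 ht₀.2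
    filter_upwards [hframes, hsnd.eventually hIoo, eventually_differentiableAt hY]
      with q ⟨hq, B, hB, h1, h2⟩ hq' hd
    have h3 := (h.evolves q.2 hq (Φ q.1)).hasDerivAt (Icc_mem_nhds hq'.1 hq'.2)
    have h4 := hasDerivAt_line (q := q) (s := 0) (timeDir n)
      (f := fun q : Eucl n × ℝ => X q.2 (Φ q.1)) (by simpa using hd)
    have h5 : HasDerivAt (fun s : ℝ => X (q.2 + s) (Φ q.1))
        (-(meanCurvature (X q.2) (ν q.2) (Φ q.1)) • ν q.2 (Φ q.1)) 0 := by
      exact HasDerivAt.comp_const_add (f := fun s => X s (Φ q.1)) q.2 0 (by rwa [add_zero])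
    have h6 : sliceMean (fun q : Eucl n × ℝ => X q.2 (Φ q.1))
        (fun q : Eucl n × ℝ => ν q.2 (Φ q.1)) q = meanCurvature (X q.2) (ν q.2) (Φ q.1) := by
      rw [sliceMean, h1, h2, trace_shapeMatrix_comp hB, meanCurvature_eq]
    rw [h6]
    have h7 : (fun s : ℝ => X (q + s • timeDir n).2 (Φ (q + s • timeDir n).1)) =
        fun s : ℝ => X (q.2 + s) (Φ q.1) := by
      ext1 s; simp
    rw [zero_smul, add_zero, h7] at h4
    exact h4.unique h5
  · filter_upwards [hgraph] with y hy w
    have := hy w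
    simpa only [Function.comp_apply, hez₀] using this
  · refine eq_tangent_add_normal (hs₀.norm_normal x₀) fun w => ?_
    obtain ⟨v, hv⟩ := hJ w
    have hν₀ : ν t₀ x₀ = ν t₀ (e.symm z₀) := by rw [hez₀]
    rw [hv, hDF, hν₀]
    exact hs₀.normal_orthogonal (e.symm z₀) (paramDeriv e.symm z₀ v)

end IsConvexMeanCurvatureFlow

/-! ### The pinching quantity along the flow -/

namespace IsConvexMeanCurvatureFlow

variable {n : ℕ} {M : Type*} [TopologicalSpace M] [ChartedSpace (Eucl n) M]
  {X ν : ℝ → M → Eucl (n + 1)} {δ : ℝ} {Ω : ℝ → Set (Eucl (n + 1))}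

/-- The speed is `|H|`. This lets compactness in space-time be controlled by the initial embedding
alone. -/
theorem norm_sub_initial_le (h : IsConvexMeanCurvatureFlow δ Ω X ν) {D : ℝ} (hD0 : 0 ≤ D)
    (hD : ∀ t ∈ Set.Icc 0 δ, ∀ x, |meanCurvature (X t) (ν t) x| ≤ D) {t : ℝ}
    (ht : t ∈ Set.Icc 0 δ) (x : M) : ‖X t x - X 0 x‖ ≤ D * δ := by
  have h1 := norm_image_sub_le_of_norm_deriv_le_segment' (a := 0) (b := δ) (C := D)
    (f := fun s => X s x) (fun s hs => h.evolves s hs x) (fun s hs => by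
      have hs' : s ∈ Set.Icc 0 δ := ⟨hs.1, hs.2.le⟩
      rw [norm_smul, norm_neg, (h.hypersurface s hs').norm_normal, mul_one, Real.norm_eq_abs]
      exact hD s hs' x) t ht
  refine h1.trans ?_
  rw [sub_zero]
  exact mul_le_mul_of_nonneg_left ht.2 hD0

/-- The rescaled pinching quantity, made proper by a multiple of `|X|² + 2nt`. -/
noncomputable def pinchingQuantity (X ν : ℝ → M → Eucl (n + 1)) (α K ε : ℝ) (q : M × ℝ) : ℝ :=
  Real.exp (-(K * q.2)) * (kappaOne (X q.2) (ν q.2) q.1 - α * meanCurvature (X q.2) (ν q.2) q.1) +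
    ε * (‖X q.2 q.1‖ ^ 2 + 2 * n * q.2)

/-- With `κ₁` isolated, the other side is continuous in space-time, so lower semicontinuity passes
from `κ₁` to `pinchingQuantity`. -/
theorem lt_pinchingQuantity_iff (α K ε y : ℝ) (q : M × ℝ) :
    y < pinchingQuantity X ν α K ε q ↔
      α * meanCurvature (X q.2) (ν q.2) q.1 +
        Real.exp (K * q.2) * (y - ε * (‖X q.2 q.1‖ ^ 2 + 2 * n * q.2)) <
        kappaOne (X q.2) (ν q.2) q.1 := by
  have hpos := Real.exp_pos (K * q.2)
  rw [pinchingQuantity, ← sub_lt_iff_lt_add, Real.exp_neg, inv_mul_eq_div, lt_div_iff₀ hpos]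
  constructor <;> intro h <;> linarith

variable [IsManifold (𝓡 n) ∞ M]

/-- The smallest principal curvature cannot touch the barrier at an interior time. -/
theorem kappaOne_not_touching (h : IsConvexMeanCurvatureFlow δ Ω X ν) (hn : 1 ≤ n) {x₀ : M}
    {t₀ : ℝ} (ht₀ : t₀ ∈ Set.Ioo 0 δ) {α K ε m : ℝ}
    (hge : ∀ t ∈ Set.Icc 0 t₀, ∀ x, α * meanCurvature (X t) (ν t) x - barrier n K ε m t (X t x) ≤
      kappaOne (X t) (ν t) x)
    (heq : kappaOne (X t₀) (ν t₀) x₀ =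
      α * meanCurvature (X t₀) (ν t₀) x₀ - barrier n K ε m t₀ (X t₀ x₀))
    (hη : 0 < barrier n K ε m t₀ (X t₀ x₀))
    (hK : (shapeMatrix (differential (X t₀) x₀) (differential (ν t₀) x₀) *
      shapeMatrix (differential (X t₀) x₀) (differential (ν t₀) x₀)).trace < K) : False := by
  obtain ⟨Φ, J, rfl, hG, hframes⟩ := h.exists_isGraphFlow x₀ ht₀
  set Y : Eucl n × ℝ → Eucl (n + 1) := fun q => X q.2 (Φ q.1) with hY
  set N : Eucl n × ℝ → Eucl (n + 1) := fun q => ν q.2 (Φ q.1) with hN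
  have hcurv : ∀ᶠ q : Eucl n × ℝ in 𝓝 (0, t₀), q.2 ∈ Set.Icc 0 δ ∧
      sliceMean Y N q = meanCurvature (X q.2) (ν q.2) (Φ q.1) ∧
      ∃ w, ‖w‖ = 1 ∧ inner ℝ (sliceDeriv N q w) (sliceDeriv Y q w) =
          kappaOne (X q.2) (ν q.2) (Φ q.1) * ‖sliceDeriv Y q w‖ ^ 2 ∧
        ∀ x, kappaOne (X q.2) (ν q.2) (Φ q.1) * ‖sliceDeriv Y q x‖ ^ 2 ≤
          inner ℝ (sliceDeriv N q x) (sliceDeriv Y q x) := by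
    filter_upwards [hframes] with q ⟨hq, B, hB, h1, h2⟩
    have hs := h.hypersurface q.2 hq
    have h3 := exists_rayleigh_min (L := sliceDeriv Y q) (N := sliceDeriv N q) hn
      (by rw [h1]; exact (hs.immersion _).comp hB)
      (by
        rw [h1, h2]
        exact fun v w => inner_differential_comm hs.contMDiff hs.normal_contMDiff
          hs.normal_orthogonal _ _ _)
    refine ⟨hq, by rw [sliceMean, h1, h2, trace_shapeMatrix_comp hB, meanCurvature_eq], ?_⟩
    rw [kappaOne_eq, ← spectrum_shapeMatrix_comp hB, ← h1, ← h2]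
    exact h3
  obtain ⟨-, hmean, v, hv, hveq, -⟩ := hcurv.self_of_nhds
  refine hG.not_touching (α := α) (K := K) (ε := ε) (m := m) hv ?_ ?_ hη ?_
  · filter_upwards [hcurv] with q ⟨hq, hH, _, _, _, hle⟩ hqt w
    refine le_trans (mul_le_mul_of_nonneg_right ?_ (by positivity)) (hle w)
    rw [hH]
    exact hge q.2 ⟨hq.1, hqt⟩ (Φ q.1)
  · rw [hveq, hmean]
    simp only at heq ⊢
    rw [heq]
  · obtain ⟨-, B, hB, h1, h2⟩ := hframes.self_of_nhds
    rw [h1, h2, trace_sq_shapeMatrix_comp hB]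
    exact hK

theorem trace_sq_bounds (h : IsConvexMeanCurvatureFlow δ Ω X ν) {C t : ℝ} (ht : t ∈ Set.Icc 0 δ)
    {x : M} (hC : normA (X t) (ν t) x ≤ C) :
    (shapeMatrix (differential (X t) x) (differential (ν t) x) *
      shapeMatrix (differential (X t) x) (differential (ν t) x)).trace ≤ C ^ 2 ∧
    |meanCurvature (X t) (ν t) x| ≤ √(n * C ^ 2) := by
  have hs := h.hypersurface t ht
  obtain ⟨h1, h2⟩ := sq_trace_shapeMatrix_le (hs.immersion x)
    (inner_differential_comm hs.contMDiff hs.normal_contMDiff hs.normal_orthogonal x)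
  have h3 : (shapeMatrix (differential (X t) x) (differential (ν t) x) *
      shapeMatrix (differential (X t) x) (differential (ν t) x)).trace ≤ C ^ 2 := by
    rw [← Real.sq_sqrt h1, ← normA_eq]
    exact pow_le_pow_left₀ (Real.sqrt_nonneg _) hC 2
  refine ⟨h3, Real.abs_le_sqrt ?_⟩
  rw [meanCurvature_eq]
  exact h2.trans (mul_le_mul_of_nonneg_left h3 (Nat.cast_nonneg n))

theorem lowerSemicontinuousOn_pinchingQuantity (h : IsConvexMeanCurvatureFlow δ Ω X ν)
    (hn : 1 ≤ n) (hδ : 0 < δ) (α K ε : ℝ) :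
    LowerSemicontinuousOn (pinchingQuantity X ν α K ε) (Set.univ ×ˢ Set.Icc 0 δ) := by
  rintro ⟨x₀, t₀⟩ ⟨-, ht₀⟩ y hy
  replace hy := (lt_pinchingQuantity_iff α K ε y (x₀, t₀)).1 hy
  have hX : Tendsto (fun q : M × ℝ => X q.2 q.1) (𝓝[Set.univ ×ˢ Set.Icc 0 δ] (x₀, t₀))
      (𝓝 (X t₀ x₀)) := h.smooth.continuousOn (x₀, t₀) ⟨Set.mem_univ _, ht₀⟩
  have ht : Tendsto (fun q : M × ℝ => q.2) (𝓝[Set.univ ×ˢ Set.Icc 0 δ] (x₀, t₀)) (𝓝 t₀) :=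
    (continuousAt_snd.tendsto).mono_left nhdsWithin_le_nhds
  have hexp : Tendsto (fun q : M × ℝ => Real.exp (K * q.2))
      (𝓝[Set.univ ×ˢ Set.Icc 0 δ] (x₀, t₀)) (𝓝 (Real.exp (K * t₀))) :=
    (Real.continuous_exp.tendsto _).comp (ht.const_mul K)
  have hc := ((h.tendsto_meanCurvature hδ (x₀ := x₀) ht₀).const_mul α).add
    (hexp.mul ((((hX.norm.pow 2).add (ht.const_mul (2 * n : ℝ))).const_mul ε).const_sub y))
  filter_upwards [h.eventually_lt_kappaOne hn hδ ht₀ hc hy] with q hq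
  exact (lt_pinchingQuantity_iff α K ε y q).2 hq

/-- If the pinching fails somewhere then it fails at an interior time. -/
theorem exists_interior_lt (h : IsConvexMeanCurvatureFlow δ Ω X ν) (hn : 1 ≤ n) (hδ : 0 < δ)
    {α t : ℝ} (ht : t ∈ Set.Ioc 0 δ) {x : M}
    (hlt : kappaOne (X t) (ν t) x < α * meanCurvature (X t) (ν t) x) :
    ∃ s ∈ Set.Ioo 0 δ, kappaOne (X s) (ν s) x < α * meanCurvature (X s) (ν s) x := by
  have ht' : t ∈ Set.Icc 0 δ := ⟨ht.1.le, ht.2⟩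
  have h1 := h.eventually_kappaOne_lt hn hδ ht' (x₀ := x)
    (c := fun q => α * meanCurvature (X q.2) (ν q.2) q.1)
    ((h.tendsto_meanCurvature hδ ht').const_mul α) hlt
  have h2 : Tendsto (fun s : ℝ => (x, s)) (𝓝[Set.Ioo 0 t] t)
      (𝓝[Set.univ ×ˢ Set.Icc 0 δ] (x, t)) := by
    refine tendsto_nhdsWithin_iff.2 ⟨?_, ?_⟩
    · exact ((Continuous.prodMk_right x).tendsto t).mono_left nhdsWithin_le_nhds
    · filter_upwards [self_mem_nhdsWithin] with s hs
      exact ⟨Set.mem_univ _, hs.1.le, hs.2.le.trans ht.2⟩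
  have : (𝓝[Set.Ioo 0 t] t).NeBot := right_nhdsWithin_Ioo_neBot ht.1
  obtain ⟨s, hs1, hs2⟩ := ((h2.eventually h1).and self_mem_nhdsWithin).exists
  exact ⟨s, ⟨hs2.1, hs2.2.trans_le ht.2⟩, hs1⟩

end IsConvexMeanCurvatureFlow

end PinchedMCF

/-! ### The maximum principle argument on the noncompact flow -/

theorem mainTheorem3 {n : ℕ} (hn : 1 ≤ n) {M : Type*} [TopologicalSpace M]
    [ChartedSpace (PinchedMCF.Eucl n) M] [IsManifold (𝓡 n) ∞ M]
    (δ : ℝ) (hδ : 0 < δ) (Ω : ℝ → Set (PinchedMCF.Eucl (n + 1)))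
    (X ν : ℝ → M → PinchedMCF.Eucl (n + 1))
    (hflow : PinchedMCF.IsConvexMeanCurvatureFlow δ Ω X ν)
    (hconv : ∀ t ∈ Set.Icc 0 δ, PinchedMCF.IsLocallyUniformlyConvex (X t) (ν t))
    (hbound : ∃ C : ℝ, ∀ t ∈ Set.Icc 0 δ, ∀ x, PinchedMCF.normA (X t) (ν t) x ≤ C)
    (α : ℝ)
    (hpinch : ∀ x, α * PinchedMCF.meanCurvature (X 0) (ν 0) x ≤
      PinchedMCF.kappaOne (X 0) (ν 0) x) :
    ∀ t ∈ Set.Icc 0 δ, ∀ x, α * PinchedMCF.meanCurvature (X t) (ν t) x ≤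
      PinchedMCF.kappaOne (X t) (ν t) x := by
  by_contra! hcon
  obtain ⟨t₂, ht₂, x₁, hlt₂⟩ := hcon
  have ht₂0 : 0 < t₂ := by
    refine lt_of_le_of_ne ht₂.1 ?_
    rintro rfl
    exact absurd (hpinch x₁) (not_le.2 hlt₂)
  -- Failure persists to slightly earlier times, so it can be placed before `δ`. The minimum found
  -- below then lies at an interior time, where two-sided derivatives exist.
  obtain ⟨t₁, ht₁, hlt⟩ := hflow.exists_interior_lt hn hδ ⟨ht₂0, ht₂.2⟩ hlt₂
  obtain ⟨C, hC⟩ := hbound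
  set D := √(n * C ^ 2) with hDdef
  have hD0 : 0 ≤ D := Real.sqrt_nonneg _
  have hD : ∀ t ∈ Set.Icc 0 δ, ∀ x, |PinchedMCF.meanCurvature (X t) (ν t) x| ≤ D :=
    fun t ht x => (hflow.trace_sq_bounds ht (hC t ht x)).2
  have hκ : ∀ t ∈ Set.Icc 0 δ, ∀ x, 0 < PinchedMCF.kappaOne (X t) (ν t) x := fun t ht x => by
    obtain ⟨c, hc, hc'⟩ := hconv t ht x
    exact hc.trans_le hc'.self_of_nhds
  -- The maximum principle needs `K` strictly above `|A|²`.
  set K := C ^ 2 + 1 with hKdef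
  have hK0 : 0 ≤ K := by positivity
  -- a barrier small enough not to cover the failure of the pinching
  obtain ⟨ε, hε, hQ₁⟩ : ∃ ε : ℝ, 0 < ε ∧
      PinchedMCF.IsConvexMeanCurvatureFlow.pinchingQuantity X ν α K ε (x₁, t₁) < 0 := by
    set a := Real.exp (-(K * t₁)) * (α * PinchedMCF.meanCurvature (X t₁) (ν t₁) x₁ -
      PinchedMCF.kappaOne (X t₁) (ν t₁) x₁) with ha
    have ha0 : 0 < a := mul_pos (Real.exp_pos _) (sub_pos.2 hlt)
    set r := ‖X t₁ x₁‖ ^ 2 + 2 * n * t₁ with hr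
    have hr0 : 0 ≤ r := by have := ht₁.1; positivity
    -- `Q` at the failure point equals `-a + εr`, which this `ε` makes negative.
    refine ⟨a / (r + 1), by positivity, ?_⟩
    have h1 : a / (r + 1) * r < a := by
      rw [div_mul_eq_mul_div, div_lt_iff₀ (by positivity)]
      nlinarith
    simp only [PinchedMCF.IsConvexMeanCurvatureFlow.pinchingQuantity]
    rw [← hr]
    linarith
  set Q := PinchedMCF.IsConvexMeanCurvatureFlow.pinchingQuantity X ν α K ε with hQdef
  have hsub : Set.Icc 0 t₁ ⊆ Set.Icc 0 δ := Set.Icc_subset_Icc_right ht₁.2.le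
  -- Where `|X| ≥ ρ`, the term `ε|X|²` exceeds `|α|D`, the most that `-αH` can subtract; positivity
  -- of `κ₁` does the rest. The extra `Dδ` in the radius below allows for the motion since time `0`.
  set ρ := √((|α| * D + 1) / ε) with hρ
  set S : Set (M × ℝ) := (X 0 ⁻¹' Metric.closedBall 0 (ρ + D * δ)) ×ˢ Set.Icc 0 t₁ with hS
  have hout : ∀ t ∈ Set.Icc 0 t₁, ∀ x, (x, t) ∉ S → 0 < Q (x, t) := by
    intro t ht x hx
    have hx' : ρ + D * δ < ‖X 0 x‖ := by
      by_contra! hle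
      exact hx ⟨by simpa using hle, ht⟩
    have h1 := hflow.norm_sub_initial_le hD0 hD (hsub ht) x
    have h2 : ρ ≤ ‖X t x‖ := by
      have := norm_sub_norm_le (X 0 x) (X t x)
      rw [norm_sub_rev] at this
      linarith
    have h3 : (|α| * D + 1) / ε ≤ ‖X t x‖ ^ 2 := by
      rw [← Real.sq_sqrt (by positivity : 0 ≤ (|α| * D + 1) / ε)]
      exact pow_le_pow_left₀ (Real.sqrt_nonneg _) h2 2
    have h4 : |α| * D + 1 ≤ ε * ‖X t x‖ ^ 2 := by
      rw [div_le_iff₀ hε] at h3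
      linarith
    have h5 : α * PinchedMCF.meanCurvature (X t) (ν t) x ≤ |α| * D := by
      refine (le_abs_self _).trans ?_
      rw [abs_mul]
      exact mul_le_mul_of_nonneg_left (hD t (hsub ht) x) (abs_nonneg _)
    have h6 := hκ t (hsub ht) x
    have h7 : Real.exp (-(K * t)) ≤ 1 := Real.exp_le_one_iff.2 (by
      have := mul_nonneg hK0 ht.1
      linarith)
    have h8 : -(|α| * D) ≤ Real.exp (-(K * t)) * (PinchedMCF.kappaOne (X t) (ν t) x -
        α * PinchedMCF.meanCurvature (X t) (ν t) x) := by
      have h9 : -(|α| * D) ≤ PinchedMCF.kappaOne (X t) (ν t) x -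
        α * PinchedMCF.meanCurvature (X t) (ν t) x := by linarith
      have h10 : 0 ≤ |α| * D := by positivity
      have := mul_le_mul_of_nonneg_left h9 (Real.exp_pos (-(K * t))).le
      nlinarith
    have h11 : 0 ≤ ε * (2 * n * t) := by have := ht.1; positivity
    simp only [hQdef, PinchedMCF.IsConvexMeanCurvatureFlow.pinchingQuantity]
    linarith
  have hmem₁ : (x₁, t₁) ∈ S := by
    by_contra hx
    exact absurd (hout t₁ ⟨ht₁.1.le, le_rfl⟩ x₁ hx) (not_lt.2 hQ₁.le)
  have hs₀ := hflow.hypersurface 0 ⟨le_rfl, hδ.le⟩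
  have hcompact : IsCompact S := by
    refine IsCompact.prod ?_ isCompact_Icc
    -- The initial hypersurface is the whole frontier, hence closed, so preimages of balls are
    -- compact.
    have hemb : Topology.IsClosedEmbedding (X 0) :=
      ⟨hs₀.isEmbedding, by rw [hs₀.range_eq]; exact isClosed_frontier⟩
    exact hemb.isCompact_preimage (isCompact_closedBall _ _)
  have hlsc : LowerSemicontinuousOn Q S :=
    (hflow.lowerSemicontinuousOn_pinchingQuantity hn hδ α K ε).mono
      (Set.prod_mono (Set.subset_univ _) hsub)
  obtain ⟨⟨x₀, t₀⟩, hmem₀, hmin⟩ := hlsc.exists_isMinOn ⟨_, hmem₁⟩ hcompact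
  have hQ₀ : Q (x₀, t₀) < 0 := lt_of_le_of_lt (hmin hmem₁) hQ₁
  have hglobal : ∀ t ∈ Set.Icc 0 t₁, ∀ x, Q (x₀, t₀) ≤ Q (x, t) := by
    intro t ht x
    by_cases hx : (x, t) ∈ S
    · exact hmin hx
    · exact (hQ₀.trans (hout t ht x hx)).le
  have ht₀ : t₀ ∈ Set.Icc 0 t₁ := hmem₀.2
  have ht₀0 : 0 < t₀ := by
    refine lt_of_le_of_ne ht₀.1 ?_
    rintro rfl
    refine absurd hQ₀ (not_lt.2 ?_)
    have := sub_nonneg.2 (hpinch x₀)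
    simp only [hQdef, PinchedMCF.IsConvexMeanCurvatureFlow.pinchingQuantity]
    positivity
  -- the pinching quantity in terms of the barrier
  have hform : ∀ t x, PinchedMCF.kappaOne (X t) (ν t) x =
      α * PinchedMCF.meanCurvature (X t) (ν t) x +
        Real.exp (K * t) * (Q (x, t) - ε * (‖X t x‖ ^ 2 + 2 * n * t)) := by
    intro t x
    simp only [hQdef, PinchedMCF.IsConvexMeanCurvatureFlow.pinchingQuantity]
    rw [add_sub_cancel_right, ← mul_assoc, ← Real.exp_add, add_neg_cancel, Real.exp_zero]
    ring
  -- With `m` equal to minus the minimum of `Q`, the inequality `Q ≥ -m` says that `κ₁ ≥ αH` minus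
  -- the barrier, with equality at the minimum point; the barrier is positive because the minimum is
  -- negative.
  refine hflow.kappaOne_not_touching hn (x₀ := x₀) (t₀ := t₀) ⟨ht₀0, ht₀.2.trans_lt ht₁.2⟩
    (α := α) (K := K) (ε := ε) (m := -Q (x₀, t₀)) ?_ ?_ ?_ ?_
  · intro t ht x
    rw [hform t x, PinchedMCF.barrier]
    have h1 := mul_le_mul_of_nonneg_left (hglobal t ⟨ht.1, ht.2.trans ht₀.2⟩ x)
      (Real.exp_pos (K * t)).le
    linarith
  · rw [hform t₀ x₀, PinchedMCF.barrier]
    ring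
  · rw [PinchedMCF.barrier]
    have h1 : 0 ≤ ε * (‖X t₀ x₀‖ ^ 2 + 2 * n * t₀) := by positivity
    exact mul_pos (Real.exp_pos _) (by linarith)
  · have := (hflow.trace_sq_bounds (hsub ht₀) (hC t₀ (hsub ht₀) x₀)).1
    linarith
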